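/- Let $\Phi$ be a reduced irreducible (crystallographic) root system with ambient real space $V$; the coroots $\Phi^\vee$ lie in the dual space $V^*$. Fix a set of simple roots $\Pi\subset\Phi^+$, and let $\alpha_0$ be the highest root. Let $W$ be the Weyl group acting on $V^*$, let $Q^\vee=\mathbb{Z}\Phi^\vee$ be the coroot lattice and $P^\vee=\{\lambda\in V^* : \langle\lambda,\alpha\rangle\in\mathbb{Z}\ \forall\alpha\in\Phi\}$ the coweight lattice. For $\lambda\in V^*$ let $\mathrm{t}_\lambda$ be the translation of $V^*$ by $\lambda$. A $W$-lattice is a full-rank lattice in $V^*$ that is stable under $W$; for a $W$-stable subgroup $\Lambda\subseteq V^*$ put $W_\Lambda:=\mathrm{t}(\Lambda)\rtimes W\le\mathrm{Aff}(V^*)$. Let $W_{\mathrm a}\le\mathrm{Aff}(V^*)$ be the affine Weyl group, generated by the reflections $s_\alpha$ ($\alpha\in\Pi$) and the affine reflection $s_{\alpha_0,1}:\lambda\mapsto\lambda-(\langle\lambda,\alpha_0\rangle-1)\alpha_0^\vee$; let $\widehat{W_{\mathrm a}}:=W_{P^\vee}$ be the extended affine Weyl group, let $\mathcal{A}_0=\{\lambda\in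 V^* : 0\le\langle\lambda,\alpha\rangle\le 1\ \forall\alpha\in\Phi^+\}$ be the closed fundamental alcove, and let $\Omega:=\{\phi\in\widehat{W_{\mathrm a}} : \phi(\mathcal{A}_0)=\mathcal{A}_0\}$. Then $\Omega$ is finite and $\widehat{W_{\mathrm a}}=W_{\mathrm a}\rtimes\Omega$ (internal semidirect product). Let $\pi:\widehat{W_{\mathrm a}}\to\Omega$, $w\omega\mapsto\omega$ ($w\in W_{\mathrm a}$, $\omega\in\Omega$), be the natural projection, a well-defined group homomorphism. The maps $$\Lambda\longmapsto\Omega_\Lambda:=\pi(W_\Lambda),\qquad H\longmapsto\Lambda(H):=\pi^{-1}(H)\cap P^\vee=\{\lambda\in P^\vee : \pi(\mathrm{t}_\lambda)\in H\}$$ are mutually inverse bijections between the set of $W$-lattices $\Lambda$ with $Q^\vee\subseteq\Lambda\subseteq P^\vee$ and the set of subgroups $H\le\Omega$. Moreover, for every $W$-lattice $\Lambda$ with $Q^\vee\subseteq\Lambda\subseteq P^\vee$, one has $$[\Omega:\Omega_\Lambda]=[P^\vee:\Lambda],\qquad |\Omega_\Lambda|=[\Lambda:Q^\vee],$$ and $W_\Lambda=W_{\mathrm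 a}\rtimes\Omega_\Lambda$ (internal semidirect product). -/

import Mathlib

noncomputable section

/-- The subgroup `G` is the internal semidirect product of its subgroups `N` (normal in `G`) and
`H`: the group `H` acts on `N` by conjugation and `(n, h) ↦ n * h` is a group isomorphism from the
external semidirect product `N ⋊ H` for this action onto `G`. -/
def Subgroup.IsInternalSemidirect {A : Type*} [Group A] (G N H : Subgroup A) : Prop :=
  ∃ (φ : H →* MulAut N) (e : N ⋊[φ] H ≃* G),
    (∀ (h : H) (n : N), (φ h n : A) = (h : A) * n * (h : A)⁻¹) ∧
      ∀ x : N ⋊[φ] H, (e x : A) = (x.left : A) * (x.right : A)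

/-- The group `t(L)` of translations of a real vector space `E` by the elements of `L`. -/
def AddSubgroup.translations {E : Type*} [AddCommGroup E] [Module ℝ E] (L : AddSubgroup E) :
    Subgroup (E ≃ᵃ[ℝ] E) :=
  (AddSubgroup.toSubgroup L).map (AffineEquiv.constVAddHom ℝ E)

/-- A (full rank) lattice of a finite dimensional real vector space: the group of integral linear
combinations of the vectors of a real basis. -/
def AddSubgroup.IsFullLattice {E : Type*} [AddCommGroup E] [Module ℝ E] (L : AddSubgroup E) :
    Prop :=
  ∃ B : Module.Basis (Fin (Module.finrank ℝ E)) ℝ E, L = AddSubgroup.closure (Set.range B)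

namespace RootPairing

variable {ι V V' : Type*} [AddCommGroup V] [Module ℝ V] [AddCommGroup V'] [Module ℝ V']
  (P : RootPairing ι ℝ V V')

/-- The coroot lattice `Q^∨` in the space `V'` of coroots. -/
def corootLattice : AddSubgroup V' :=
  AddSubgroup.closure (Set.range P.coroot)

/-- The coweight lattice `P^∨`: the vectors that pair integrally with every root. -/
def coweightLattice : AddSubgroup V' where
  carrier := {x | ∀ i, ∃ n : ℤ, P.root' i x = n}
  zero_mem' i := ⟨0, by simp⟩
  add_mem' {x y} hx hy i := by
    obtain ⟨m, hm⟩ := hx i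
    obtain ⟨n, hn⟩ := hy i
    exact ⟨m + n, by simp [hm, hn]⟩
  neg_mem' {x} hx i := by
    obtain ⟨m, hm⟩ := hx i
    exact ⟨-m, by simp [hm]⟩

/-- The affine reflection `s_{α,k} : x ↦ x - (⟨x, α⟩ - k) α^∨`, where `α` is the root of index
`i`. -/
def affineReflection (i : ι) (k : ℤ) : V' ≃ᵃ[ℝ] V' :=
  AffineEquiv.constVAdd ℝ V' ((k : ℝ) • P.coroot i) * (P.coreflection i).toAffineEquiv

lemma affineReflection_apply (i : ι) (k : ℤ) (x : V') :
    P.affineReflection i k x = x - (P.root' i x - k) • P.coroot i := by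
  simp only [affineReflection, AffineEquiv.mul_def, AffineEquiv.trans_apply,
    LinearEquiv.coe_toAffineEquiv, AffineEquiv.constVAdd_apply, vadd_eq_add,
    P.coreflection_apply]
  module

/-- The Weyl group `W`, as a group of linear automorphisms of the space of coroots. -/
def coWeylGroup : Subgroup (V' ≃ₗ[ℝ] V') :=
  Subgroup.closure (Set.range P.coreflection)

/-- The Weyl group `W`, seen inside the group of affine automorphisms of the space of coroots. -/
def affCoWeylGroup : Subgroup (V' ≃ᵃ[ℝ] V') where
  carrier := {g | ∃ w ∈ P.coWeylGroup, g = w.toAffineEquiv}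
  one_mem' := ⟨1, one_mem _, by ext; rfl⟩
  mul_mem' := by
    rintro _ _ ⟨v, hv, rfl⟩ ⟨w, hw, rfl⟩
    exact ⟨v * w, mul_mem hv hw, by ext; rfl⟩
  inv_mem' := by
    rintro _ ⟨v, hv, rfl⟩
    exact ⟨v⁻¹, inv_mem hv, by ext; rfl⟩

/-- A `W`-lattice: a lattice that is stable under the Weyl group. -/
structure IsWLattice (L : AddSubgroup V') : Prop where
  isFullLattice : L.IsFullLattice
  apply_mem : ∀ w ∈ P.coWeylGroup, ∀ x ∈ L, w x ∈ L

/-- The `W`-lattices between the coroot lattice and the coweight lattice. -/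
def intermediateLattices : Set (AddSubgroup V') :=
  {L | P.IsWLattice L ∧ P.corootLattice ≤ L ∧ L ≤ P.coweightLattice}

/-- The group `W_L = t(L) ⋊ W` generated by the translations by `L` and the Weyl group. -/
def intermediateAffineWeylGroup (L : AddSubgroup V') : Subgroup (V' ≃ᵃ[ℝ] V') :=
  L.translations ⊔ P.affCoWeylGroup

/-- For `W`-stable `L`, the elements of `W_L` are exactly the maps `x ↦ w x + l` with `l ∈ L` and
`w ∈ W`. -/
lemma mem_intermediateAffineWeylGroup_iff {L : AddSubgroup V'}
    (hL : ∀ w ∈ P.coWeylGroup, ∀ x ∈ L, w x ∈ L) {g : V' ≃ᵃ[ℝ] V'} :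
    g ∈ P.intermediateAffineWeylGroup L ↔
      ∃ l ∈ L, ∃ w ∈ P.coWeylGroup, ∀ x, g x = w x + l := by
  constructor
  · intro hg
    rw [intermediateAffineWeylGroup, Subgroup.sup_eq_closure] at hg
    induction hg using Subgroup.closure_induction with
    | mem g hg =>
      rcases hg with ⟨l, hl, rfl⟩ | ⟨w, hw, rfl⟩
      · exact ⟨l.toAdd, hl, 1, one_mem _, fun x ↦ by simp [add_comm]⟩
      · exact ⟨0, zero_mem _, w, hw, fun x ↦ by simp⟩
    | one => exact ⟨0, zero_mem _, 1, one_mem _, fun x ↦ by simp⟩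
    | mul g h _ _ hg hh =>
      obtain ⟨l, hl, w, hw, h1⟩ := hg
      obtain ⟨m, hm, v, hv, h2⟩ := hh
      refine ⟨w m + l, add_mem (hL w hw m hm) hl, w * v, mul_mem hw hv, fun x ↦ ?_⟩
      simp [h1, h2, add_assoc]
    | inv g _ hg =>
      obtain ⟨l, hl, w, hw, h1⟩ := hg
      refine ⟨-(w⁻¹ l), neg_mem (hL _ (inv_mem hw) l hl), w⁻¹, inv_mem hw, fun x ↦ ?_⟩
      have h3 : ∀ y, w (w⁻¹ y) = y := fun y ↦ w.apply_symm_apply y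
      have h4 : g (g⁻¹ x) = x := g.apply_symm_apply x
      apply g.injective
      rw [h4, h1, map_add, map_neg, h3, h3]
      abel
  · rintro ⟨l, hl, w, hw, h⟩
    have : g = AffineEquiv.constVAddHom ℝ V' (Multiplicative.ofAdd l) * w.toAffineEquiv := by
      ext x
      simp [h, add_comm]
    rw [this]
    exact mul_mem (Subgroup.mem_sup_left ⟨_, hl, rfl⟩) (Subgroup.mem_sup_right ⟨w, hw, rfl⟩)

/-- The extended affine Weyl group `t(P^∨) ⋊ W`. -/
def extendedAffineWeylGroup : Subgroup (V' ≃ᵃ[ℝ] V') :=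
  P.intermediateAffineWeylGroup P.coweightLattice

namespace Base

variable {P} (b : P.Base)

/-- The root of index `i` is the highest root: for every root `β`, the difference of this root and
`β` is a sum of simple roots. -/
def IsHighestRoot (i : ι) : Prop :=
  ∀ j, P.root i - P.root j ∈ AddSubmonoid.closure (P.root '' b.support)

/-- The affine Weyl group `W_a`, generated by the reflections `s_{α,0}` in the simple roots `α` and
the affine reflection `s_{α₀,1}` in the highest root `α₀`. -/
def affineWeylGroup : Subgroup (V' ≃ᵃ[ℝ] V') :=
  Subgroup.closure
    ({g | ∃ i ∈ b.support, g = P.affineReflection i 0} ∪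
      {g | ∃ i, b.IsHighestRoot i ∧ g = P.affineReflection i 1})

/-- The closed fundamental alcove. -/
def fundamentalAlcove : Set V' :=
  {x | ∀ i, b.IsPos i → 0 ≤ P.root' i x ∧ P.root' i x ≤ 1}

/-- The stabilizer `Ω` of the fundamental alcove in the extended affine Weyl group. -/
def alcoveStabilizer : Subgroup (V' ≃ᵃ[ℝ] V') where
  carrier := {g | g ∈ P.extendedAffineWeylGroup ∧ g '' b.fundamentalAlcove = b.fundamentalAlcove}
  one_mem' := ⟨one_mem _, Set.image_id _⟩
  mul_mem' := by
    rintro g h ⟨hg, hg'⟩ ⟨hh, hh'⟩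
    refine ⟨mul_mem hg hh, ?_⟩
    rw [AffineEquiv.coe_mul, Set.image_comp, hh', hg']
  inv_mem' := by
    rintro g ⟨hg, hg'⟩
    refine ⟨inv_mem hg, ?_⟩
    conv_lhs => rw [← hg', ← Set.image_comp, ← AffineEquiv.coe_mul, inv_mul_cancel]
    exact Set.image_id _

/-- `π` is the natural projection of the extended affine Weyl group `W_a ⋊ Ω` onto `Ω`: it sends
`w * ω` to `ω`. -/
def IsNaturalProjection (π : P.extendedAffineWeylGroup →* b.alcoveStabilizer) : Prop :=
  ∀ (g : P.extendedAffineWeylGroup), ∀ w ∈ b.affineWeylGroup, ∀ ω : b.alcoveStabilizer,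
    (g : V' ≃ᵃ[ℝ] V') = w * (ω : V' ≃ᵃ[ℝ] V') → π g = ω

variable {b} (π : P.extendedAffineWeylGroup →* b.alcoveStabilizer)

/-- The subgroup `Ω_L = π(W_L)` of `Ω`. -/
def omegaOfLattice (L : AddSubgroup V') : Subgroup b.alcoveStabilizer :=
  ((P.intermediateAffineWeylGroup L).subgroupOf P.extendedAffineWeylGroup).map π

/-- The group `π⁻¹(H) ∩ P^∨`: the coweights whose translation lies in `π⁻¹(H)`. -/
def latticeOfSubgroup (H : Subgroup b.alcoveStabilizer) : AddSubgroup V' :=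
  Subgroup.toAddSubgroup' (((H.comap π).map P.extendedAffineWeylGroup.subtype).comap
    (AffineEquiv.constVAddHom ℝ V')) ⊓ P.coweightLattice

end Base

end RootPairing

end

/-! ### Semidirect products and an abstract exchange argument. -/

section Group

variable {A : Type*} [Group A]

/-! Elements of the extended group permute the roots, viewed as affine functions on `V'`, up to
integer shifts, so they permute the affine root hyperplanes. A generic point `p` of the alcove
therefore controls everything: an element moving `p` into the open alcove stabilizes the alcove.

Existence in `W_a ⋊ Ω`: given `g`, choose `w` in `W_a` so that `w g p` is separated from `p` by as
few hyperplanes as possible. If it were outside the alcove, reflecting in a violated wall would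
lower the count (`separation_wallReflection_lt`). Uniqueness: an element of `W_a` moving `p` into
the open alcove is trivial, by the exchange condition (`eq_one_of_apply_mem_openAlcove`). Both rest
on one fact: a wall reflection carries `p` across no hyperplane but its own wall
(`exists_floor_wallReflection`). For the wall of the highest root `α₀` this holds because `⟨β,
α₀^∨⟩` is 0 or 1 for every positive root `β ≠ α₀`.

The same bound gives `W_a = t(Q^∨) ⋊ W` (`affineWeylGroup_eq`). Hence `λ ↦ π(t_λ)` is a homomorphism
from `P^∨` onto `Ω` (surjective because `π` kills `W`) with kernel `Q^∨`. Every group between `Q^∨`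
and `P^∨` is automatically a `W`-lattice, so the bijections and the indices are the correspondence
theorem for `P^∨/Q^∨ ≅ Ω`. -/

/-- A criterion for a group to be the internal semidirect product of two subgroups. -/
lemma Subgroup.IsInternalSemidirect.of_disjoint {G N H : Subgroup A} (hN : N ≤ G) (hH : H ≤ G)
    (hnorm : ∀ g ∈ G, ∀ n ∈ N, g * n * g⁻¹ ∈ N) (hdisj : N ⊓ H = ⊥)
    (hmul : ∀ g ∈ G, ∃ n ∈ N, ∃ h ∈ H, g = n * h) :
    G.IsInternalSemidirect N H := by
  have hle : H ≤ Subgroup.normalizer N := by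
    intro h hh
    rw [Subgroup.mem_normalizer_iff]
    refine fun n ↦ ⟨hnorm h (hH hh) n, fun hn ↦ ?_⟩
    simpa [mul_assoc] using hnorm h⁻¹ (inv_mem (hH hh)) _ hn
  let F := SemidirectProduct.monoidHomSubgroup hle
  have hF (x) : F x = (x.left : A) * (x.right : A) := rfl
  have hFG (x) : F x ∈ G := by
    rw [hF]
    exact mul_mem (hN x.left.2) (hH x.right.2)
  refine ⟨(N.normalizerMonoidHom).comp (Subgroup.inclusion hle),
    MulEquiv.ofBijective (F.codRestrict G hFG) ⟨?_, ?_⟩, fun _ _ ↦ rfl, fun _ ↦ rfl⟩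
  · rw [injective_iff_map_eq_one]
    intro x hx
    replace hx : (x.left : A) * (x.right : A) = 1 := congrArg Subtype.val hx
    have hl : (x.left : A) = (x.right : A)⁻¹ := eq_inv_of_mul_eq_one_left hx
    have hl' : (x.left : A) = 1 := by
      rw [← Subgroup.mem_bot, ← hdisj]
      exact ⟨x.left.2, by rw [hl]; exact H.inv_mem x.right.2⟩
    ext
    · simpa using hl'
    · simpa [hl'] using hx
  · rintro ⟨g, hg⟩
    obtain ⟨n, hn, h, hh, rfl⟩ := hmul g hg
    exact ⟨⟨⟨n, hn⟩, ⟨h, hh⟩⟩, rfl⟩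

/-- An internal semidirect product projects onto its complement. -/
lemma Subgroup.IsInternalSemidirect.exists_projection {G N H : Subgroup A}
    (h : G.IsInternalSemidirect N H) :
    ∃ π : G →* H, ∀ (g : G), ∀ n ∈ N, ∀ k : H, (g : A) = n * (k : A) → π g = k := by
  obtain ⟨φ, e, -, he⟩ := h
  refine ⟨SemidirectProduct.rightHom.comp e.symm.toMonoidHom, fun g n hn k hg ↦ ?_⟩
  have : e ⟨⟨n, hn⟩, k⟩ = g := Subtype.ext ((he _).trans hg.symm)
  simp [← this]

/-- A form of the exchange condition: if a group is generated by involutions that exchange the two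
sides of a wall each, and each generator moves the base chamber only across its own wall, then no
nontrivial element keeps the base chamber on the positive side of all walls. -/
lemma eq_one_of_forall_pos_of_exchange {κ : Type*} (r : κ → A) (Pos : κ → A → Prop)
    (hr : ∀ s, r s * r s = 1) (hone : ∀ s, Pos s 1)
    (hneg : ∀ s, ∀ w, Pos s w → ¬ Pos s (r s * w))
    (hexch : ∀ s t, ∀ w ∈ Subgroup.closure (Set.range r), Pos s w → ¬ Pos s (w * r t) →
      r s * w = w * r t)
    {w : A} (hw : w ∈ Subgroup.closure (Set.range r)) (hpos : ∀ s, Pos s w) : w = 1 := by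
  have hmem (l : List κ) : (l.map r).prod ∈ Subgroup.closure (Set.range r) := by
    refine Subgroup.list_prod_mem _ fun x hx ↦ ?_
    obtain ⟨s, -, rfl⟩ := List.mem_map.mp hx
    exact Subgroup.subset_closure ⟨s, rfl⟩
  have hlist : ∃ l : List κ, (l.map r).prod = w := by
    clear hpos
    induction hw using Subgroup.closure_induction'' with
    | mem x hx => obtain ⟨s, rfl⟩ := hx; exact ⟨[s], by simp⟩
    | inv_mem x hx =>
      obtain ⟨s, rfl⟩ := hx
      exact ⟨[s], by simpa using eq_inv_of_mul_eq_one_left (hr s)⟩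
    | one => exact ⟨[], rfl⟩
    | mul x y _ _ hx hy =>
      obtain ⟨l, rfl⟩ := hx
      obtain ⟨m, rfl⟩ := hy
      exact ⟨l ++ m, by simp⟩
  -- Some letter of the word is where its prefixes first leave the positive side of `s`. By `hexch`
  -- that letter can be deleted at the cost of a factor `r s` in front.
  have key (s : κ) (l : List κ) : ¬ Pos s (l.map r).prod →
      ∃ m : List κ, m.length < l.length ∧ (l.map r).prod = r s * (m.map r).prod := by
    induction l using List.reverseRecOn with
    | nil => intro h; exact absurd (hone s) (by simpa using h)
    | append_singleton l t ih =>
      intro h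
      by_cases hl : Pos s (l.map r).prod
      · refine ⟨l, by simp, ?_⟩
        simpa using (hexch s t _ (hmem l) hl (by simpa using h)).symm
      · obtain ⟨m, hm, hm'⟩ := ih hl
        exact ⟨m ++ [t], by simpa using hm, by simp [hm', mul_assoc]⟩
  obtain ⟨l, rfl⟩ := hlist
  clear hw
  generalize hn : l.length = n
  induction n using Nat.strong_induction_on generalizing l with
  | _ n ih =>
    match l, hn with
    | [], _ => rfl
    | s :: l, hn =>
      -- The tail of the word lies on the negative side of its first letter `s`, so `key` extracts a
      -- second `r s`, which cancels the first and leaves a shorter word.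
      have h1 : (l.map r).prod = r s * ((s :: l).map r).prod := by
        rw [List.map_cons, List.prod_cons, ← mul_assoc, hr, one_mul]
      obtain ⟨m, hm, hm'⟩ := key s l (h1 ▸ hneg s _ (hpos s))
      have h2 : ((s :: l).map r).prod = (m.map r).prod := by
        rw [List.map_cons, List.prod_cons, hm', ← mul_assoc, hr, one_mul]
      rw [h2] at hpos ⊢
      refine ih m.length ?_ m hpos rfl
      simp only [List.length_cons] at hn
      lia

end Group

/-! ### Weyl group action on coweights, and affine reflections. -/

namespace RootPairing

variable {ι V V' : Type*} [AddCommGroup V] [Module ℝ V] [AddCommGroup V'] [Module ℝ V']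
  (P : RootPairing ι ℝ V V')

lemma root'_reflectionPerm_self (i : ι) (x : V') :
    P.root' (P.reflectionPerm i i) x = -P.root' i x := by
  simp [root', root_reflectionPerm]

lemma exists_perm_of_mem_coWeylGroup {w : V' ≃ₗ[ℝ] V'} (hw : w ∈ P.coWeylGroup) :
    ∃ σ : Equiv.Perm ι, ∀ i, (∀ x, P.root' i (w x) = P.root' (σ i) x) ∧
      w (P.coroot (σ i)) = P.coroot i := by
  induction hw using Subgroup.closure_induction'' with
  | mem x hx =>
    obtain ⟨j, rfl⟩ := hx
    refine ⟨P.reflectionPerm j, fun i ↦ ⟨fun x ↦ P.flip.coroot'_reflection x, ?_⟩⟩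
    rw [coroot_reflectionPerm, coreflection_same]
  | inv_mem x hx =>
    obtain ⟨j, rfl⟩ := hx
    rw [coreflection_inv]
    refine ⟨P.reflectionPerm j, fun i ↦ ⟨fun x ↦ P.flip.coroot'_reflection x, ?_⟩⟩
    rw [coroot_reflectionPerm, coreflection_same]
  | one => exact ⟨1, by simp⟩
  | mul v w _ _ hv hw =>
    obtain ⟨σ, hσ⟩ := hv
    obtain ⟨τ, hτ⟩ := hw
    refine ⟨τ * σ, fun i ↦ ⟨fun x ↦ ?_, ?_⟩⟩
    · simp [(hσ i).1, (hτ _).1]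
    · simp [(hσ i).2, (hτ _).2]

/-- A reflection changes `x` by an integral multiple of a coroot, and the changes telescope along a
product. This makes `W`-stability automatic between `Q^∨` and `P^∨`. -/
lemma apply_sub_mem_corootLattice {w : V' ≃ₗ[ℝ] V'} (hw : w ∈ P.coWeylGroup)
    {x : V'} (hx : x ∈ P.coweightLattice) : w x - x ∈ P.corootLattice := by
  induction hw using Subgroup.closure_induction'' generalizing x with
  | mem v hv =>
    obtain ⟨j, rfl⟩ := hv
    obtain ⟨n, hn⟩ := hx j
    rw [coreflection_apply, hn, sub_sub_cancel_left, Int.cast_smul_eq_zsmul]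
    exact neg_mem (zsmul_mem (AddSubgroup.subset_closure (Set.mem_range_self j)) n)
  | inv_mem v hv =>
    obtain ⟨j, rfl⟩ := hv
    obtain ⟨n, hn⟩ := hx j
    rw [coreflection_inv, coreflection_apply, hn, sub_sub_cancel_left, Int.cast_smul_eq_zsmul]
    exact neg_mem (zsmul_mem (AddSubgroup.subset_closure (Set.mem_range_self j)) n)
  | one => simp
  | mul v w _ hw' hv hw =>
    obtain ⟨σ, hσ⟩ := P.exists_perm_of_mem_coWeylGroup hw'
    have hwx : w x ∈ P.coweightLattice := fun i ↦ by
      obtain ⟨n, hn⟩ := hx (σ i)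
      exact ⟨n, by rw [(hσ i).1, hn]⟩
    have := add_mem (hv hwx) (hw hx)
    rwa [sub_add_sub_cancel] at this

/-- Every group between the coroot and the coweight lattice is stable under the Weyl group. -/
lemma apply_mem_of_corootLattice_le {L : AddSubgroup V'} (hQ : P.corootLattice ≤ L)
    (hP : L ≤ P.coweightLattice) : ∀ w ∈ P.coWeylGroup, ∀ x ∈ L, w x ∈ L := by
  intro w hw x hx
  simpa using add_mem (hQ (P.apply_sub_mem_corootLattice hw (hP hx))) hx

lemma corootLattice_le_coweightLattice [P.IsCrystallographic] :
    P.corootLattice ≤ P.coweightLattice := by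
  refine (AddSubgroup.closure_le _).mpr ?_
  rintro _ ⟨j, rfl⟩ i
  exact ⟨P.pairingIn ℤ i j, by simpa using (P.algebraMap_pairingIn ℤ i j).symm⟩

lemma mem_extendedAffineWeylGroup_iff [P.IsCrystallographic] {g : V' ≃ᵃ[ℝ] V'} :
    g ∈ P.extendedAffineWeylGroup ↔
      ∃ l ∈ P.coweightLattice, ∃ w ∈ P.coWeylGroup, ∀ x, g x = w x + l :=
  P.mem_intermediateAffineWeylGroup_iff
    (P.apply_mem_of_corootLattice_le P.corootLattice_le_coweightLattice le_rfl)

/-- The extended affine Weyl group permutes the affine root hyperplanes. -/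
lemma exists_perm_of_mem_extendedAffineWeylGroup [P.IsCrystallographic] {g : V' ≃ᵃ[ℝ] V'}
    (hg : g ∈ P.extendedAffineWeylGroup) :
    ∃ (σ : Equiv.Perm ι) (k : ι → ℤ), ∀ i, (∀ x, P.root' i (g x) = P.root' (σ i) x + k i) ∧
      ∀ (c : ℝ) x, g (x + c • P.coroot (σ i)) = g x + c • P.coroot i := by
  obtain ⟨l, hl, w, hw, h⟩ := P.mem_extendedAffineWeylGroup_iff.mp hg
  obtain ⟨σ, hσ⟩ := P.exists_perm_of_mem_coWeylGroup hw
  choose k hk using hl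
  refine ⟨σ, k, fun i ↦ ⟨fun x ↦ ?_, fun c x ↦ ?_⟩⟩
  · rw [h, map_add, (hσ i).1, hk]
  · rw [h, h, map_add, map_smul, (hσ i).2]
    abel

lemma affineReflection_mul_self (i : ι) (k : ℤ) :
    P.affineReflection i k * P.affineReflection i k = 1 := by
  ext x
  simp only [AffineEquiv.coe_mul, Function.comp_apply, affineReflection_apply, map_sub, map_smul,
    root'_coroot_eq_pairing, pairing_same, smul_eq_mul, AffineEquiv.coe_one, id_eq]
  module

lemma root'_affineReflection (i j : ι) (k : ℤ) (x : V') :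
    P.root' j (P.affineReflection i k x) =
      P.root' j x - (P.root' i x - k) * P.pairing j i := by
  simp [affineReflection_apply]

lemma root'_affineReflection_self (i : ι) (k : ℤ) (x : V') :
    P.root' i (P.affineReflection i k x) = 2 * k - P.root' i x := by
  rw [root'_affineReflection, pairing_same]
  ring

lemma affineReflection_reflectionPerm_self (i : ι) (k : ℤ) :
    P.affineReflection (P.reflectionPerm i i) (-k) = P.affineReflection i k := by
  ext x
  simp only [affineReflection_apply, root'_reflectionPerm_self, coroot_reflectionPerm,
    coreflection_apply_self, Int.cast_neg]
  module

lemma affineReflection_zero (i : ι) :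
    P.affineReflection i 0 = (P.coreflection i).toAffineEquiv := by
  ext x
  simp [affineReflection_apply, coreflection_apply]

lemma affineReflection_eq_mul (i : ι) (k : ℤ) :
    P.affineReflection i k =
      AffineEquiv.constVAddHom ℝ V' (Multiplicative.ofAdd (k • P.coroot i)) *
        (P.coreflection i).toAffineEquiv := by
  ext x
  simp only [affineReflection_apply, AffineEquiv.coe_mul, Function.comp_apply,
    LinearEquiv.coe_toAffineEquiv, coreflection_apply, AffineEquiv.constVAddHom_apply,
    toAdd_ofAdd, AffineEquiv.constVAdd_apply, vadd_eq_add]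
  module

lemma affineReflection_mem_intermediate (i : ι) (k : ℤ) :
    P.affineReflection i k ∈ P.intermediateAffineWeylGroup P.corootLattice := by
  rw [affineReflection_eq_mul]
  refine mul_mem (Subgroup.mem_sup_left ⟨Multiplicative.ofAdd (k • P.coroot i), ?_, rfl⟩)
    (Subgroup.mem_sup_right ⟨_, Subgroup.subset_closure (Set.mem_range_self i), rfl⟩)
  exact AddSubgroup.zsmul_mem P.corootLattice
    (AddSubgroup.subset_closure (Set.mem_range_self i)) k

/-- Conjugation of an affine reflection by an affine map that matches the hyperplanes. -/
lemma affineReflection_mul_eq {g : V' ≃ᵃ[ℝ] V'} {i j : ι} {k : ℤ}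
    (h : ∀ x, P.root' i (g x) = P.root' j x + k)
    (h' : ∀ (c : ℝ) x, g (x + c • P.coroot j) = g x + c • P.coroot i) (m : ℤ) :
    P.affineReflection i (m + k) * g = g * P.affineReflection j m := by
  ext x
  simp only [AffineEquiv.coe_mul, Function.comp_apply, affineReflection_apply, h]
  rw [sub_eq_add_neg x, ← neg_smul, h']
  push_cast
  module

end RootPairing

/-! ### Heights and the cone of simple roots. -/

namespace RootPairing.Base

section Height

variable {ι V V' : Type*} [AddCommGroup V] [Module ℝ V] [AddCommGroup V'] [Module ℝ V']
  {P : RootPairing ι ℝ V V'} (b : P.Base)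

lemma exists_root'_eq [P.IsRootSystem] (c : b.support → ℝ) :
    ∃ x, ∀ j : b.support, P.root' j x = c j := by
  refine ⟨P.toLinearMap.flip.toPerfPair.symm (b.toWeightBasis.constr ℝ c), fun j ↦ ?_⟩
  change P.toLinearMap.flip.toPerfPair (P.toLinearMap.flip.toPerfPair.symm _) (P.root j) = _
  rw [LinearEquiv.apply_symm_apply, ← b.toWeightBasis_apply, Module.Basis.constr_basis]

/-- This point, the sum of the fundamental coweights, turns order statements about roots into
inequalities of real numbers. -/
lemma exists_root'_eq_height [P.IsRootSystem] : ∃ x, ∀ i, P.root' i x = b.height i := by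
  obtain ⟨x, hx⟩ := b.exists_root'_eq 1
  refine ⟨x, fun i ↦ ?_⟩
  obtain ⟨f, -, -, hf⟩ := b.exists_root_eq_sum_int i
  rw [height_eq_sum hf, root', hf, map_sum, LinearMap.sum_apply, Int.cast_sum]
  refine Finset.sum_congr rfl fun j hj ↦ ?_
  have := hx ⟨j, hj⟩
  rw [root'] at this
  simp [this]

variable {b}

lemma apply_nonneg_of_mem_closure {y : V} (hy : y ∈ AddSubmonoid.closure (P.root '' b.support))
    {x : V'} (hx : ∀ j ∈ b.support, 0 ≤ P.root' j x) : 0 ≤ P.toLinearMap y x := by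
  induction hy using AddSubmonoid.closure_induction with
  | mem y hy => obtain ⟨j, hj, rfl⟩ := hy; exact hx j hj
  | zero => simp
  | add y z _ _ hy hz => rw [map_add]; exact add_nonneg hy hz

lemma apply_pos_of_mem_closure {y : V} (hy : y ∈ AddSubmonoid.closure (P.root '' b.support))
    (hy0 : y ≠ 0) {x : V'} (hx : ∀ j ∈ b.support, 0 < P.root' j x) :
    0 < P.toLinearMap y x := by
  -- Nonvanishing does not pass to summands, so the induction carries the disjunction.
  have : y = 0 ∨ 0 < P.toLinearMap y x := by
    clear hy0
    induction hy using AddSubmonoid.closure_induction with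
    | mem y hy => obtain ⟨j, hj, rfl⟩ := hy; exact .inr (hx j hj)
    | zero => simp
    | add y z _ _ hy hz =>
      rcases hy with rfl | hy
      · simpa using hz
      · rcases hz with rfl | hz
        · simpa using Or.inr hy
        · right
          rw [map_add]
          exact add_pos hy hz
  exact this.resolve_left hy0

lemma isPos_iff_mem_closure [P.IsRootSystem] {i : ι} :
    b.IsPos i ↔ P.root i ∈ AddSubmonoid.closure (P.root '' b.support) := by
  obtain ⟨x, hx⟩ := b.exists_root'_eq_height
  have hx' : ∀ j ∈ b.support, 0 ≤ P.root' j x := fun j hj ↦ by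
    rw [hx, height_one_of_mem_support hj]; simp
  constructor
  · intro h
    refine (b.root_mem_or_neg_mem i).resolve_right fun h' ↦ ?_
    have := apply_nonneg_of_mem_closure h' hx'
    have h2 := hx i
    rw [root'] at h2
    rw [map_neg, LinearMap.neg_apply, h2, neg_nonneg] at this
    have h3 : 0 < b.height i := h
    have : b.height i ≤ 0 := by exact_mod_cast this
    lia
  · intro h
    have := apply_nonneg_of_mem_closure h hx'
    have h2 := hx i
    rw [root'] at h2
    rw [h2] at this
    rw [isPos_iff']
    exact_mod_cast this

/-- A combination of simple roots with natural coefficients whose negative is one as well is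
zero. -/
lemma eq_zero_of_mem_closure_of_neg_mem [P.IsRootSystem] {y : V}
    (hy : y ∈ AddSubmonoid.closure (P.root '' b.support))
    (hy' : -y ∈ AddSubmonoid.closure (P.root '' b.support)) : y = 0 := by
  by_contra h
  obtain ⟨x, hx⟩ := b.exists_root'_eq_height
  have hx' : ∀ j ∈ b.support, 0 < P.root' j x := fun j hj ↦ by
    rw [hx, height_one_of_mem_support hj]; simp
  have h1 := apply_pos_of_mem_closure hy h hx'
  have h2 := apply_pos_of_mem_closure hy' (neg_ne_zero.mpr h) hx'
  rw [map_neg, LinearMap.neg_apply] at h2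
  linarith

lemma isPos_reflectionPerm_self_iff (i : ι) :
    b.IsPos (P.reflectionPerm i i) ↔ ¬ b.IsPos i :=
  IsPos.neg_iff_not b i

end Height

/-! ### Existence of the highest root. -/

section HighestRoot

variable {ι V V' : Type*} [Finite ι] [AddCommGroup V] [Module ℝ V] [AddCommGroup V'] [Module ℝ V']
  {P : RootPairing ι ℝ V V'} [P.IsRootSystem] (b : P.Base)

/-- The root of index `i` is maximal for the order defined by the base. -/
def IsMaximalRoot (i : ι) : Prop :=
  ∀ j, P.root j - P.root i ∈ AddSubmonoid.closure (P.root '' b.support) → j = i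

/-- Among the finitely many roots above `j`, one of greatest height is maximal, since height is
strictly increasing for this order. -/
lemma exists_isMaximalRoot_ge (j : ι) : ∃ i, b.IsMaximalRoot i ∧
    P.root i - P.root j ∈ AddSubmonoid.closure (P.root '' b.support) := by
  obtain ⟨x, hx⟩ := b.exists_root'_eq_height
  have hx' : ∀ j ∈ b.support, 0 < P.root' j x := fun j hj ↦ by
    rw [hx, height_one_of_mem_support hj]; simp
  obtain ⟨i, hi, hmax⟩ := (Set.toFinite {i | P.root i - P.root j ∈
    AddSubmonoid.closure (P.root '' b.support)}).exists_maximalFor b.height _ ⟨j, by simp⟩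
  refine ⟨i, fun k hk ↦ ?_, hi⟩
  by_contra hne
  have h1 := apply_pos_of_mem_closure hk (sub_ne_zero.mpr (P.root.injective.ne hne)) hx'
  have h2 : P.root k - P.root j ∈ AddSubmonoid.closure (P.root '' b.support) := by
    simpa using add_mem hk hi
  have hxk := hx k
  have hxi := hx i
  rw [root'] at hxk hxi
  rw [map_sub, LinearMap.sub_apply, hxk, hxi, sub_pos, Int.cast_lt] at h1
  have := hmax h2 h1.le
  lia

variable {b}

omit [Finite ι] in
lemma IsMaximalRoot.isPos {i : ι} (hi : b.IsMaximalRoot i) : b.IsPos i := by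
  by_contra h
  have h1 := isPos_iff_mem_closure.mp ((isPos_reflectionPerm_self_iff i).mpr h)
  have h2 : P.root (P.reflectionPerm i i) = -P.root i := by
    rw [root_reflectionPerm, reflection_apply_self]
  have h3 := hi (P.reflectionPerm i i) (by
    rw [sub_eq_add_neg, ← h2]; exact add_mem h1 h1)
  rw [h3] at h1
  exact h (isPos_iff_mem_closure.mpr h1)

variable [P.IsCrystallographic]

/-- If the pairing were negative, the sum of the two roots would be a root above the maximal one. -/
lemma IsMaximalRoot.pairingIn_nonneg {i j : ι} (hi : b.IsMaximalRoot i) (hj : j ∈ b.support) :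
    0 ≤ P.pairingIn ℤ i j := by
  by_contra! h
  have hne : P.root i ≠ -P.root j := by
    intro h'
    have h1 := isPos_iff_mem_closure.mp hi.isPos
    have h2 : P.root j ∈ AddSubmonoid.closure (P.root '' b.support) :=
      AddSubmonoid.subset_closure ⟨j, hj, rfl⟩
    exact P.ne_zero i (eq_zero_of_mem_closure_of_neg_mem h1 (by rwa [h', neg_neg]))
  obtain ⟨k, hk⟩ := P.root_add_root_mem_of_pairingIn_neg h hne
  have := hi k (by rw [hk, add_sub_cancel_left]; exact AddSubmonoid.subset_closure ⟨j, hj, rfl⟩)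
  rw [this] at hk
  exact P.ne_zero j (by simpa using hk)

/-- Every simple root occurs in a maximal root. -/
lemma IsMaximalRoot.coeff_ne_zero [P.IsReduced] [P.IsIrreducible] {i : ι} (hi : b.IsMaximalRoot i)
    {f : ι → ℕ} (hf : P.root i = ∑ j ∈ b.support, f j • P.root j) {k : ι} (hk : k ∈ b.support) :
    f k ≠ 0 := by
  intro hfk
  let s : Set ι := {j | j ∈ b.support ∧ f j ≠ 0}
  -- For a simple root `l` not occurring in `i`, every term of the expansion of `⟨i, l^∨⟩` is
  -- nonpositive, while the sum is nonnegative by maximality.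
  have hpair : ∀ l ∈ b.support, f l = 0 → ∀ j ∈ s, P.pairing j l = 0 := by
    intro l hl hfl
    have hsum : P.pairingIn ℤ i l = ∑ j ∈ b.support, f j * P.pairingIn ℤ j l := by
      have : P.pairing i l = ∑ j ∈ b.support, f j * P.pairing j l := by
        rw [← root_coroot'_eq_pairing, hf, map_sum]
        simp
      simp_rw [← P.algebraMap_pairingIn ℤ] at this
      have h' : ((P.pairingIn ℤ i l : ℤ) : ℝ) =
          ((∑ j ∈ b.support, f j * P.pairingIn ℤ j l : ℤ) : ℝ) := by
        push_cast
        simpa using this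
      exact_mod_cast h'
    have hle : ∀ j ∈ b.support, (f j : ℤ) * P.pairingIn ℤ j l ≤ 0 := by
      intro j hj
      by_cases hjl : j = l
      · simp [hjl, hfl]
      · exact mul_nonpos_of_nonneg_of_nonpos (by simp) (b.pairingIn_le_zero_of_ne hjl hj hl)
    have hzero : ∑ j ∈ b.support, (f j : ℤ) * P.pairingIn ℤ j l = 0 :=
      le_antisymm (Finset.sum_nonpos hle) (hsum ▸ hi.pairingIn_nonneg hl)
    rintro j ⟨hj, hfj⟩
    have := (Finset.sum_eq_zero_iff_of_nonpos hle).mp hzero j hj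
    have h0 : P.pairingIn ℤ j l = 0 := by simpa [hfj] using this
    rw [← P.algebraMap_pairingIn ℤ, h0, map_zero]
  -- The span of the occurring simple roots is stable under all simple reflections, hence everything
  -- by irreducibility; linear independence then excludes a missing simple root.
  let q := Submodule.span ℝ (P.root '' s)
  have hq : ∀ l ∈ b.support, q ∈ Module.End.invtSubmodule (P.reflection l) := by
    intro l hl
    by_cases hfl : f l = 0
    · refine (Module.End.mem_invtSubmodule _).mpr (Submodule.span_le.mpr ?_)
      rintro _ ⟨j, hj, rfl⟩
      have : P.reflection l (P.root j) = P.root j := by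
        rw [reflection_apply_root, hpair l hl hfl j hj, zero_smul, sub_zero]
      change P.reflection l (P.root j) ∈ q
      rw [this]
      exact Submodule.subset_span ⟨j, hj, rfl⟩
    · exact Submodule.mem_invtSubmodule_reflection_of_mem _ _
        (Submodule.subset_span ⟨l, ⟨hl, hfl⟩, rfl⟩)
  have hiq : P.root i ∈ q := by
    rw [hf]
    refine Submodule.sum_mem _ fun j hj ↦ ?_
    by_cases hfj : f j = 0
    · simp [hfj]
    · exact Submodule.smul_of_tower_mem _ _ (Submodule.subset_span ⟨j, ⟨hj, hfj⟩, rfl⟩)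
  have htop : q = ⊤ := IsIrreducible.eq_top_of_invtSubmodule_reflection (P := P) q
    ((b.forall_mem_support_invtSubmodule_iff q).mp hq)
    (fun h ↦ P.ne_zero i (by simpa [h] using hiq))
  have hks : k ∉ s := fun h ↦ h.2 hfk
  have hli : LinearIndepOn ℝ P.root (insert k s) :=
    b.linearIndepOn_root.mono (Set.insert_subset hk fun j hj ↦ hj.1)
  exact ((linearIndepOn_insert hks).mp hli).2 (by change P.root k ∈ q; simp [htop])

/-- Expand `i` in simple roots: all coefficients are positive, all pairings with `j` are
nonnegative, and one of these is positive. -/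
lemma IsMaximalRoot.pairingIn_pos [P.IsReduced] [P.IsIrreducible] {i j : ι}
    (hi : b.IsMaximalRoot i) (hj : b.IsMaximalRoot j) : 0 < P.pairingIn ℤ i j := by
  obtain ⟨f, -, hf⟩ := b.exists_root_eq_sum_nat_or_neg i
  replace hf : P.root i = ∑ j ∈ b.support, f j • P.root j := by
    refine hf.resolve_right fun h ↦ P.ne_zero i ?_
    refine eq_zero_of_mem_closure_of_neg_mem (isPos_iff_mem_closure.mp hi.isPos) ?_
    rw [h, neg_neg]
    exact sum_mem fun j hj ↦ nsmul_mem (AddSubmonoid.subset_closure (Set.mem_image_of_mem _ hj)) _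
  have hsum : P.pairingIn ℤ i j = ∑ l ∈ b.support, f l * P.pairingIn ℤ l j := by
    have : P.pairing i j = ∑ l ∈ b.support, f l * P.pairing l j := by
      rw [← root_coroot'_eq_pairing, hf, map_sum]
      simp
    simp_rw [← P.algebraMap_pairingIn ℤ] at this
    have h' : ((P.pairingIn ℤ i j : ℤ) : ℝ) =
        ((∑ l ∈ b.support, f l * P.pairingIn ℤ l j : ℤ) : ℝ) := by
      push_cast
      simpa using this
    exact_mod_cast h'
  rw [hsum]
  obtain ⟨k, hk, hk'⟩ := hj.isPos.exists_mem_support_pos_pairingIn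
  refine Finset.sum_pos' (fun l hl ↦ mul_nonneg (by simp) ?_) ⟨k, hk, mul_pos ?_ hk'⟩
  · by_contra! h
    rw [P.pairingIn_lt_zero_iff] at h
    exact h.not_ge (hj.pairingIn_nonneg hl)
  · exact_mod_cast Nat.pos_of_ne_zero (hi.coeff_ne_zero hf hk)

/-- Otherwise the difference is a root, positive or negative, which puts one of the two maximal
roots above the other. -/
lemma IsMaximalRoot.eq [P.IsReduced] [P.IsIrreducible] {i j : ι}
    (hi : b.IsMaximalRoot i) (hj : b.IsMaximalRoot j) : i = j := by
  by_contra hne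
  obtain ⟨k, hk⟩ := P.root_sub_root_mem_of_pairingIn_pos (hi.pairingIn_pos hj) hne
  rcases b.root_mem_or_neg_mem k with h | h
  · exact hne (hj i (hk ▸ h))
  · exact hne (hi j (by rwa [hk, neg_sub] at h)).symm

variable (b)

/-- An irreducible crystallographic root system has a highest root. -/
lemma exists_isHighestRoot [P.IsReduced] [P.IsIrreducible] : ∃ i, b.IsHighestRoot i := by
  have := IsIrreducible.nontrivial P
  obtain ⟨j₀⟩ : Nonempty ι := by
    by_contra! h
    exact absurd (IsRootSystem.span_root_eq_top (P := P)) (by simp [Set.range_eq_empty])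
  obtain ⟨i, hi, -⟩ := b.exists_isMaximalRoot_ge j₀
  refine ⟨i, fun j ↦ ?_⟩
  obtain ⟨k, hk, hkj⟩ := b.exists_isMaximalRoot_ge j
  rwa [hk.eq hi] at hkj

end HighestRoot

end RootPairing.Base

namespace RootPairing.Base

/-! ### Pairings with the highest root. -/

section Highest

variable {ι V V' : Type*} [AddCommGroup V] [Module ℝ V] [AddCommGroup V'] [Module ℝ V']
  {P : RootPairing ι ℝ V V'} {b : P.Base}

lemma root_reflectionPerm_self (i : ι) : P.root (P.reflectionPerm i i) = -P.root i := by
  rw [root_reflectionPerm, reflection_apply_self]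

lemma reflectionPerm_self_involutive (i : ι) :
    P.reflectionPerm (P.reflectionPerm i i) (P.reflectionPerm i i) = i :=
  P.root.injective (by rw [root_reflectionPerm_self, root_reflectionPerm_self, neg_neg])

variable [P.IsRootSystem]

lemma IsHighestRoot.isPos {i : ι} (hi : b.IsHighestRoot i) : b.IsPos i := by
  rw [isPos_iff_mem_closure]
  refine (b.root_mem_or_neg_mem i).elim id fun h ↦ ?_
  have h1 := hi (P.reflectionPerm i i)
  rw [root_reflectionPerm_self, sub_neg_eq_add] at h1
  simpa using add_mem h1 h

/-- Both `β - n α₀` and its negative are roots, hence lie below `α₀`. For `n < 0` this forces `-β`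
into the positive cone; for `n ≥ 2` it forces `β ≥ α₀`. -/
lemma IsHighestRoot.pairingIn_eq [P.IsCrystallographic] {i j : ι} (hi : b.IsHighestRoot i)
    (hj : b.IsPos j) (hij : j ≠ i) : P.pairingIn ℤ j i = 0 ∨ P.pairingIn ℤ j i = 1 := by
  have hi' := isPos_iff_mem_closure.mp hi.isPos
  have hj' := isPos_iff_mem_closure.mp hj
  obtain ⟨n, hn⟩ : ∃ n, n = P.pairingIn ℤ j i := ⟨_, rfl⟩
  have hk : P.root (P.reflectionPerm i j) = P.root j - n • P.root i := by
    rw [root_reflectionPerm, reflection_apply_root' ℤ, hn]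
  have h1 := hi (P.reflectionPerm i j)
  have h2 := hi (P.reflectionPerm (P.reflectionPerm i j) (P.reflectionPerm i j))
  rw [root_reflectionPerm_self] at h2
  rw [hk] at h1 h2
  rw [← hn]
  by_contra! hne
  rcases lt_or_ge n 0 with h | h
  · obtain ⟨m, rfl⟩ : ∃ m : ℕ, n = -(m + 1) := ⟨(-n - 1).toNat, by lia⟩
    refine P.ne_zero j (eq_zero_of_mem_closure_of_neg_mem hj' ?_)
    convert add_mem h1 (nsmul_mem hi' m) using 1
    module
  · obtain ⟨m, rfl⟩ : ∃ m : ℕ, n = m + 2 := ⟨(n - 2).toNat, by lia⟩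
    refine hij (P.root.injective (sub_eq_zero.mp (eq_zero_of_mem_closure_of_neg_mem (b := b) ?_ ?_)))
    · convert add_mem h2 (nsmul_mem hi' m) using 1
      module
    · rw [neg_sub]
      exact hi j

end Highest

/-! ### The open alcove and its walls. -/

section Alcove

variable {ι V V' : Type*} [AddCommGroup V] [Module ℝ V] [AddCommGroup V'] [Module ℝ V']
  {P : RootPairing ι ℝ V V'} (b : P.Base)

/-- The open fundamental alcove. -/
def openAlcove : Set V' :=
  {x | ∀ i, b.IsPos i → 0 < P.root' i x ∧ P.root' i x < 1}

/-- The walls of the fundamental alcove: a pair `(i, k)` stands for the hyperplane on which the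
root of index `i` takes the value `k`, the alcove lying on the side of larger values. -/
def walls : Set (ι × ℤ) :=
  {q | q.1 ∈ b.support ∧ q.2 = 0} ∪
    {q | ∃ i, b.IsHighestRoot i ∧ q = (P.reflectionPerm i i, -1)}

/-- The reflection in a wall of the fundamental alcove. -/
def wallReflection (q : b.walls) : V' ≃ᵃ[ℝ] V' :=
  P.affineReflection q.1.1 q.1.2

lemma affineWeylGroup_eq_closure : b.affineWeylGroup =
    Subgroup.closure (Set.range b.wallReflection) := by
  rw [affineWeylGroup]
  congr 1
  ext g
  constructor
  · rintro (⟨i, hi, rfl⟩ | ⟨i, hi, rfl⟩)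
    · exact ⟨⟨(i, 0), .inl ⟨hi, rfl⟩⟩, rfl⟩
    · exact ⟨⟨(_, -1), .inr ⟨i, hi, rfl⟩⟩, P.affineReflection_reflectionPerm_self i 1⟩
  · rintro ⟨⟨⟨i, k⟩, ⟨hi, hk⟩ | ⟨i, hi, h⟩⟩, rfl⟩
    · obtain rfl : k = 0 := hk
      exact .inl ⟨i, hi, rfl⟩
    · obtain ⟨rfl, rfl⟩ := Prod.mk.inj h
      exact .inr ⟨i, hi, P.affineReflection_reflectionPerm_self i 1⟩

lemma openAlcove_subset_fundamentalAlcove : b.openAlcove ⊆ b.fundamentalAlcove :=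
  fun _ hx i hi ↦ ⟨(hx i hi).1.le, (hx i hi).2.le⟩

variable {b}

lemma exists_floor_of_mem_openAlcove {p : V'} (hp : p ∈ b.openAlcove) (i : ι) :
    ∃ n : ℤ, (n : ℝ) < P.root' i p ∧ P.root' i p < n + 1 ∧ (b.IsPos i → n = 0) ∧
      (¬ b.IsPos i → n = -1) := by
  by_cases hi : b.IsPos i
  · exact ⟨0, by simpa using (hp i hi).1, by simpa using (hp i hi).2, fun _ ↦ rfl, absurd hi⟩
  · have := hp _ ((isPos_reflectionPerm_self_iff i).mpr hi)
    rw [root'_reflectionPerm_self] at this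
    exact ⟨-1, by push_cast; linarith, by push_cast; linarith, fun h ↦ absurd h hi, fun _ ↦ rfl⟩

lemma mem_openAlcove_of_mem_fundamentalAlcove {x : V'} (hx : x ∈ b.fundamentalAlcove)
    (hx' : ∀ i, ∀ n : ℤ, P.root' i x ≠ n) : x ∈ b.openAlcove := by
  intro i hi
  have h0 := hx' i 0
  have h1 := hx' i 1
  push_cast at h0 h1
  exact ⟨(hx i hi).1.lt_of_ne' h0, (hx i hi).2.lt_of_ne h1⟩

/-- The image of a point of the open alcove lies on no affine root hyperplane. -/
lemma root'_apply_ne_intCast [P.IsCrystallographic] {g : V' ≃ᵃ[ℝ] V'}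
    (hg : g ∈ P.extendedAffineWeylGroup) {p : V'} (hp : p ∈ b.openAlcove) (i : ι) (n : ℤ) :
    P.root' i (g p) ≠ n := by
  obtain ⟨σ, k, h⟩ := P.exists_perm_of_mem_extendedAffineWeylGroup hg
  obtain ⟨m, h1, h2, -⟩ := exists_floor_of_mem_openAlcove hp (σ i)
  rw [(h i).1]
  intro he
  have h3 : (m : ℝ) < ((n - k i : ℤ) : ℝ) := by push_cast; linarith
  have h4 : ((n - k i : ℤ) : ℝ) < ((m + 1 : ℤ) : ℝ) := by push_cast; linarith
  rw [Int.cast_lt] at h3 h4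
  lia

/-- Comparing `p` with `g p` determines the integer shift: for positive `i` it is 0 if `σ i` is
positive and 1 if it is negative. Both cases preserve the inequalities of the closed alcove. -/
lemma apply_mem_fundamentalAlcove [P.IsCrystallographic] {g : V' ≃ᵃ[ℝ] V'}
    (hg : g ∈ P.extendedAffineWeylGroup) {p : V'} (hp : p ∈ b.openAlcove)
    (hgp : g p ∈ b.openAlcove) {x : V'} (hx : x ∈ b.fundamentalAlcove) :
    g x ∈ b.fundamentalAlcove := by
  obtain ⟨σ, k, h⟩ := P.exists_perm_of_mem_extendedAffineWeylGroup hg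
  intro i hi
  have h1 := hgp i hi
  rw [(h i).1] at h1 ⊢
  by_cases hσ : b.IsPos (σ i)
  · have h2 := hp _ hσ
    have h3 : ((-1 : ℤ) : ℝ) < k i := by push_cast; linarith
    have h4 : (k i : ℝ) < (1 : ℤ) := by push_cast; linarith
    rw [Int.cast_lt] at h3 h4
    obtain h5 : k i = 0 := by lia
    simpa [h5] using hx _ hσ
  · have hσ' := (isPos_reflectionPerm_self_iff (σ i)).mpr hσ
    have h2 := hp _ hσ'
    have h6 := hx _ hσ'
    rw [root'_reflectionPerm_self] at h2 h6
    have h3 : ((0 : ℤ) : ℝ) < k i := by push_cast; linarith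
    have h4 : (k i : ℝ) < (2 : ℤ) := by push_cast; linarith
    rw [Int.cast_lt] at h3 h4
    obtain h5 : k i = 1 := by lia
    rw [h5]
    push_cast
    constructor <;> linarith

/-- An element of the extended affine Weyl group that maps some point of the open alcove into the
open alcove stabilizes the alcove. -/
lemma mem_alcoveStabilizer_of_apply_mem [P.IsCrystallographic] {g : V' ≃ᵃ[ℝ] V'}
    (hg : g ∈ P.extendedAffineWeylGroup) {p : V'} (hp : p ∈ b.openAlcove)
    (hgp : g p ∈ b.openAlcove) : g ∈ b.alcoveStabilizer := by
  refine ⟨hg, Set.Subset.antisymm ?_ ?_⟩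
  · rintro _ ⟨x, hx, rfl⟩
    exact apply_mem_fundamentalAlcove hg hp hgp hx
  · intro x hx
    have hinv : ∀ y, g⁻¹ (g y) = y := fun y ↦ g.symm_apply_apply y
    refine ⟨g⁻¹ x, apply_mem_fundamentalAlcove (inv_mem hg) hgp ?_ hx, g.apply_symm_apply x⟩
    rwa [hinv]

lemma apply_mem_openAlcove [P.IsCrystallographic] {g : V' ≃ᵃ[ℝ] V'}
    (hg : g ∈ b.alcoveStabilizer) {p : V'} (hp : p ∈ b.openAlcove) : g p ∈ b.openAlcove := by
  refine mem_openAlcove_of_mem_fundamentalAlcove ?_ (root'_apply_ne_intCast hg.1 hp)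
  rw [← hg.2]
  exact ⟨p, b.openAlcove_subset_fundamentalAlcove hp, rfl⟩

lemma lt_root'_of_mem_openAlcove [P.IsRootSystem] {p : V'} (hp : p ∈ b.openAlcove)
    {q : ι × ℤ} (hq : q ∈ b.walls) : (q.2 : ℝ) < P.root' q.1 p ∧ P.root' q.1 p < q.2 + 1 := by
  obtain ⟨hi, h0⟩ | ⟨i, hi, rfl⟩ := hq
  · simpa [h0] using hp _ (isPos_of_mem_support hi)
  · have := hp i hi.isPos
    simp only [root'_reflectionPerm_self]
    push_cast
    constructor <;> linarith

end Alcove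

section AlcoveIrreducible

variable {ι V V' : Type*} [Finite ι] [AddCommGroup V] [Module ℝ V] [AddCommGroup V'] [Module ℝ V']
  {P : RootPairing ι ℝ V V'} [P.IsRootSystem] [P.IsCrystallographic] [P.IsReduced]
  {b : P.Base}

/-- The wall inequalities suffice because each positive root is a sum of simple roots and lies below
the highest root. -/
lemma mem_openAlcove_of_forall_walls [P.IsIrreducible] {y : V'}
    (hy : ∀ q ∈ b.walls, (q.2 : ℝ) < P.root' q.1 y) : y ∈ b.openAlcove := by
  obtain ⟨i₀, hi₀⟩ := b.exists_isHighestRoot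
  have hs : ∀ j ∈ b.support, 0 < P.root' j y := fun j hj ↦ by
    simpa using hy (j, 0) (.inl ⟨hj, rfl⟩)
  have h0 := hy _ (.inr ⟨i₀, hi₀, rfl⟩)
  simp only [root'_reflectionPerm_self] at h0
  push_cast at h0
  intro i hi
  refine ⟨apply_pos_of_mem_closure (isPos_iff_mem_closure.mp hi) (P.ne_zero i) hs, ?_⟩
  have := apply_nonneg_of_mem_closure (hi₀ i) fun j hj ↦ (hs j hj).le
  rw [map_sub, LinearMap.sub_apply] at this
  change 0 ≤ P.root' i₀ y - P.root' i y at this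
  linarith

variable (b) in
lemma openAlcove_nonempty [P.IsIrreducible] : b.openAlcove.Nonempty := by
  obtain ⟨x, hx⟩ := b.exists_root'_eq_height
  obtain ⟨i₀, hi₀⟩ := b.exists_isHighestRoot
  have hpos : (0 : ℝ) < b.height i₀ := by exact_mod_cast hi₀.isPos
  -- This scaling gives the highest root the value `h / (h + 1) < 1`, where `h` is its height.
  refine ⟨((b.height i₀ : ℝ) + 1)⁻¹ • x, mem_openAlcove_of_forall_walls ?_⟩
  rintro q (⟨hi, h0⟩ | ⟨i, hi, rfl⟩)
  · rw [h0, map_smul, hx, height_one_of_mem_support hi]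
    simp only [Int.cast_zero, Int.cast_one, smul_eq_mul]
    positivity
  · have hle := apply_nonneg_of_mem_closure (hi₀ i) (x := x) fun j hj ↦ by
      rw [hx, height_one_of_mem_support hj]; simp
    rw [map_sub, LinearMap.sub_apply] at hle
    change 0 ≤ P.root' i₀ x - P.root' i x at hle
    rw [hx, hx] at hle
    rw [root'_reflectionPerm_self, map_smul, hx, smul_eq_mul]
    push_cast
    rw [neg_lt_neg_iff, inv_mul_lt_iff₀ (by positivity)]
    linarith

/-- A simple reflection permutes the other positive roots. At the affine wall, `β` keeps its value
or, if `⟨β, α₀^∨⟩ = 1`, takes the value `1 - (α₀ - β)(p)` with `α₀ - β` a positive root. -/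
lemma root'_wallReflection_mem_Ioo {p : V'} (hp : p ∈ b.openAlcove) (q : b.walls) {j : ι}
    (hj : b.IsPos j) (h1 : j ≠ q.1.1) (h2 : j ≠ P.reflectionPerm q.1.1 q.1.1) :
    0 < P.root' j (b.wallReflection q p) ∧ P.root' j (b.wallReflection q p) < 1 := by
  obtain ⟨⟨i, k⟩, ⟨hi, hk⟩ | ⟨i₀, hi, h⟩⟩ := q
  · obtain rfl : k = 0 := hk
    have : P.root' j (P.affineReflection i 0 p) = P.root' (P.reflectionPerm i j) p := by
      rw [affineReflection_zero]
      exact P.flip.coroot'_reflection p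
    simp only [wallReflection, this]
    exact hp _ (hj.reflectionPerm hi h1)
  · obtain ⟨rfl, rfl⟩ := Prod.mk.inj h
    simp only [wallReflection] at *
    rw [reflectionPerm_self_involutive] at h2
    rw [P.affineReflection_reflectionPerm_self i₀ 1, root'_affineReflection,
      ← P.algebraMap_pairingIn ℤ]
    have hp₀ := hp _ hi.isPos
    have hpj := hp _ hj
    rcases hi.pairingIn_eq hj h2 with h0 | h0
    · simpa [h0] using hpj
    · have hr : P.root (P.reflectionPerm i₀ j) = P.root j - P.root i₀ := by
        rw [root_reflectionPerm, reflection_apply_root' ℤ, h0, one_smul]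
      have hpos : b.IsPos (P.reflectionPerm (P.reflectionPerm i₀ j) (P.reflectionPerm i₀ j)) := by
        rw [isPos_iff_mem_closure, root_reflectionPerm_self, hr, neg_sub]
        exact hi j
      have := hp _ hpos
      rw [root'_reflectionPerm_self, root', hr, map_sub, LinearMap.sub_apply] at this
      change 0 < -(P.root' j p - P.root' i₀ p) ∧ -(P.root' j p - P.root' i₀ p) < 1 at this
      simp only [h0, map_one, mul_one, Int.cast_one]
      constructor <;> linarith

/-- A wall reflection moves a point of the open alcove across no hyperplane other than the wall. -/
lemma exists_floor_wallReflection {p : V'} (hp : p ∈ b.openAlcove) (q : b.walls) {j : ι}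
    (h1 : j ≠ q.1.1) (h2 : j ≠ P.reflectionPerm q.1.1 q.1.1) :
    ∃ n : ℤ, (n < P.root' j p ∧ P.root' j p < n + 1) ∧
      n < P.root' j (b.wallReflection q p) ∧ P.root' j (b.wallReflection q p) < n + 1 := by
  by_cases hj : b.IsPos j
  · refine ⟨0, ?_, ?_⟩
    · simpa using hp j hj
    · simpa using root'_wallReflection_mem_Ioo hp q hj h1 h2
  · have hj' := (isPos_reflectionPerm_self_iff j).mpr hj
    have hp1 := hp _ hj'
    have hp2 := root'_wallReflection_mem_Ioo hp q hj'
      (fun h ↦ h2 (by rw [← h, reflectionPerm_self_involutive]))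
      (fun h ↦ h1 (by
        rw [← reflectionPerm_self_involutive (P := P) j, h, reflectionPerm_self_involutive]))
    rw [root'_reflectionPerm_self] at hp1 hp2
    refine ⟨-1, ?_, ?_⟩ <;> push_cast <;> constructor <;> linarith

end AlcoveIrreducible

end RootPairing.Base

/-- Twice the number of affine root hyperplanes that separate two points. -/
noncomputable def RootPairing.separation {ι V V' : Type*} [AddCommGroup V] [Module ℝ V]
    [AddCommGroup V'] [Module ℝ V'] (P : RootPairing ι ℝ V V') (x y : V') : ℕ :=
  ∑ᶠ i, (⌊P.root' i x⌋ - ⌊P.root' i y⌋).natAbs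

namespace RootPairing.Base

/-! ### The affine Weyl group acting on alcoves. -/

section AffineWeylGroup

variable {ι V V' : Type*} [Finite ι] [AddCommGroup V] [Module ℝ V] [AddCommGroup V'] [Module ℝ V']
  {P : RootPairing ι ℝ V V'} [P.IsCrystallographic] (b : P.Base)

omit [Finite ι] [P.IsCrystallographic] in
lemma affineWeylGroup_le_intermediate :
    b.affineWeylGroup ≤ P.intermediateAffineWeylGroup P.corootLattice := by
  refine (Subgroup.closure_le _).mpr ?_
  rintro _ (⟨i, -, rfl⟩ | ⟨i, -, rfl⟩) <;> exact P.affineReflection_mem_intermediate _ _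

omit [Finite ι] in
lemma affineWeylGroup_le_extended : b.affineWeylGroup ≤ P.extendedAffineWeylGroup :=
  b.affineWeylGroup_le_intermediate.trans (sup_le_sup_right
    (Subgroup.map_mono fun _ hx ↦ P.corootLattice_le_coweightLattice hx) _)

omit [Finite ι] [P.IsCrystallographic] in
lemma wallReflection_mem (q : b.walls) : b.wallReflection q ∈ b.affineWeylGroup := by
  rw [affineWeylGroup_eq_closure]
  exact Subgroup.subset_closure ⟨q, rfl⟩

variable {b} [P.IsRootSystem] [P.IsReduced]

/-- An element of the affine Weyl group that maps a point of the open alcove into the open alcove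
is trivial. -/
lemma eq_one_of_apply_mem_openAlcove {p : V'} (hp : p ∈ b.openAlcove) {w : V' ≃ᵃ[ℝ] V'}
    (hw : w ∈ b.affineWeylGroup) (hwp : w p ∈ b.openAlcove) : w = 1 := by
  refine eq_one_of_forall_pos_of_exchange b.wallReflection
    (fun q g ↦ (q.1.2 : ℝ) < P.root' q.1.1 (g p)) (fun q ↦ P.affineReflection_mul_self _ _)
    (fun q ↦ (lt_root'_of_mem_openAlcove hp q.2).1) (fun q g h h' ↦ ?_) ?_
    (b.affineWeylGroup_eq_closure ▸ hw) (fun q ↦ (lt_root'_of_mem_openAlcove hwp q.2).1)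
  · rw [AffineEquiv.coe_mul, Function.comp_apply, wallReflection, root'_affineReflection_self] at h'
    linarith
  · intro q q' g hg h h'
    rw [← affineWeylGroup_eq_closure] at hg
    obtain ⟨σ, k, hσ⟩ :=
      P.exists_perm_of_mem_extendedAffineWeylGroup (b.affineWeylGroup_le_extended hg)
    obtain ⟨hr, hc⟩ := hσ q.1.1
    generalize σ q.1.1 = j at hr hc
    generalize k q.1.1 = k at hr
    rw [not_lt, AffineEquiv.coe_mul, Function.comp_apply, hr] at h'
    rw [hr] at h
    have hq' := lt_root'_of_mem_openAlcove hp q'.2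
    have hs : P.root' q'.1.1 (b.wallReflection q' p) = 2 * q'.1.2 - P.root' q'.1.1 p :=
      P.root'_affineReflection_self _ _ _
    -- Between `p` and its reflection in `q'`, the root `j` crosses the integer `q.1.2 - k`. Only
    -- the wall `q'` is crossed, so `j` is plus or minus its root; the minus sign is excluded
    -- because that root increases.
    by_cases h1 : j = q'.1.1
    · subst h1
      rw [hs] at h'
      have h3 : ((q.1.2 - k : ℤ) : ℝ) < ((q'.1.2 + 1 : ℤ) : ℝ) := by push_cast; linarith
      have h4 : ((q'.1.2 - 1 : ℤ) : ℝ) < ((q.1.2 - k : ℤ) : ℝ) := by push_cast; linarith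
      rw [Int.cast_lt] at h3 h4
      have h5 : q.1.2 = q'.1.2 + k := by lia
      rw [wallReflection, wallReflection, h5]
      exact P.affineReflection_mul_eq hr hc _
    · by_cases h2 : j = P.reflectionPerm q'.1.1 q'.1.1
      · subst h2
        rw [root'_reflectionPerm_self] at h h'
        rw [hs] at h'
        linarith
      · obtain ⟨n, h3, h4⟩ := exists_floor_wallReflection hp q' h1 h2
        have h5 : ((q.1.2 - k : ℤ) : ℝ) < ((n + 1 : ℤ) : ℝ) := by push_cast; linarith
        have h6 : ((n : ℤ) : ℝ) < ((q.1.2 - k : ℤ) : ℝ) := by push_cast; linarith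
        rw [Int.cast_lt] at h5 h6
        lia

/-- Moving the reflection from `y` to `p` leaves the count unchanged. It then suffices that `p`
crosses only the wall `q`, towards the side of `y`. -/
lemma separation_wallReflection_lt {p : V'} (hp : p ∈ b.openAlcove) (q : b.walls) {y : V'}
    (hy : P.root' q.1.1 y < q.1.2) :
    P.separation (b.wallReflection q y) p < P.separation y p := by
  have := Fintype.ofFinite ι
  obtain ⟨σ, k, hσ⟩ := P.exists_perm_of_mem_extendedAffineWeylGroup
    (b.affineWeylGroup_le_extended (b.wallReflection_mem q))
  have hp' : b.wallReflection q (b.wallReflection q p) = p :=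
    DFunLike.congr_fun (P.affineReflection_mul_self q.1.1 q.1.2) p
  have h1 : P.separation (b.wallReflection q y) p =
      P.separation y (b.wallReflection q p) := by
    rw [separation, separation, finsum_eq_sum_of_fintype, finsum_eq_sum_of_fintype,
      ← Equiv.sum_comp σ (fun i ↦ (⌊P.root' i y⌋ - ⌊P.root' i (b.wallReflection q p)⌋).natAbs)]
    refine Finset.sum_congr rfl fun i _ ↦ ?_
    have h2 : P.root' i p = P.root' (σ i) (b.wallReflection q p) + k i := by rw [← (hσ i).1, hp']
    rw [(hσ i).1, h2, Int.floor_add_intCast, Int.floor_add_intCast, add_sub_add_right_eq_sub]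
  have hq := lt_root'_of_mem_openAlcove hp q.2
  have hs : P.root' q.1.1 (b.wallReflection q p) = 2 * q.1.2 - P.root' q.1.1 p :=
    P.root'_affineReflection_self _ _ _
  have hlt : (⌊P.root' q.1.1 y⌋ - ⌊P.root' q.1.1 (b.wallReflection q p)⌋).natAbs <
      (⌊P.root' q.1.1 y⌋ - ⌊P.root' q.1.1 p⌋).natAbs := by
    have h2 : ⌊P.root' q.1.1 p⌋ = q.1.2 := Int.floor_eq_iff.mpr ⟨hq.1.le, hq.2⟩
    have h3 : ⌊P.root' q.1.1 (b.wallReflection q p)⌋ = q.1.2 - 1 := by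
      rw [hs, Int.floor_eq_iff]
      push_cast
      constructor <;> linarith
    have h4 : ⌊P.root' q.1.1 y⌋ < q.1.2 := Int.floor_lt.mpr hy
    lia
  rw [h1, separation, separation, finsum_eq_sum_of_fintype, finsum_eq_sum_of_fintype]
  refine Finset.sum_lt_sum (fun j _ ↦ ?_) ⟨q.1.1, Finset.mem_univ _, hlt⟩
  by_cases hj : j = q.1.1
  · subst hj
    exact hlt.le
  · by_cases hj' : j = P.reflectionPerm q.1.1 q.1.1
    · subst hj'
      simp only [root'_reflectionPerm_self]
      have h2 : ⌊-P.root' q.1.1 p⌋ = -q.1.2 - 1 := by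
        rw [Int.floor_eq_iff]
        push_cast
        constructor <;> linarith
      have h3 : ⌊-P.root' q.1.1 (b.wallReflection q p)⌋ = -q.1.2 := by
        rw [hs, Int.floor_eq_iff]
        push_cast
        constructor <;> linarith
      have h4 : -q.1.2 ≤ ⌊-P.root' q.1.1 y⌋ := by
        rw [Int.le_floor]
        push_cast
        linarith
      lia
    · obtain ⟨n, h2, h3⟩ := exists_floor_wallReflection hp q hj hj'
      rw [Int.floor_eq_iff.mpr ⟨h2.1.le, h2.2⟩, Int.floor_eq_iff.mpr ⟨h3.1.le, h3.2⟩]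

variable [P.IsIrreducible]

variable (b) in
lemma exists_eq_mul_of_mem_extendedAffineWeylGroup {g : V' ≃ᵃ[ℝ] V'}
    (hg : g ∈ P.extendedAffineWeylGroup) :
    ∃ w ∈ b.affineWeylGroup, ∃ ω ∈ b.alcoveStabilizer, g = w * ω := by
  obtain ⟨p, hp⟩ := b.openAlcove_nonempty
  let n (w : b.affineWeylGroup) : ℕ := P.separation ((w : V' ≃ᵃ[ℝ] V') (g p)) p
  let w := Function.argmin n
  have hmem : (w : V' ≃ᵃ[ℝ] V') * g ∈ P.extendedAffineWeylGroup :=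
    mul_mem (b.affineWeylGroup_le_extended w.2) hg
  have hC : ((w : V' ≃ᵃ[ℝ] V') * g) p ∈ b.openAlcove := by
    refine mem_openAlcove_of_forall_walls fun q hq ↦ ?_
    by_contra! h
    have hlt := h.lt_of_ne (root'_apply_ne_intCast hmem hp q.1 q.2)
    refine Function.not_lt_argmin n (⟨_, b.wallReflection_mem ⟨q, hq⟩⟩ * w) ?_
    exact separation_wallReflection_lt hp ⟨q, hq⟩ hlt
  exact ⟨w⁻¹, inv_mem w.2, w * g, mem_alcoveStabilizer_of_apply_mem hmem hp hC, by simp⟩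

/-- The product `s_{α₀,1} s_{α₀}` is the translation by `α₀^∨`. The work is to get all coroots from
the Weyl orbit of this one. -/
lemma affineWeylGroup_eq : b.affineWeylGroup = P.intermediateAffineWeylGroup P.corootLattice := by
  refine le_antisymm b.affineWeylGroup_le_intermediate ?_
  have hrefl (i : ι) : (P.coreflection i).toAffineEquiv ∈ b.affineWeylGroup := by
    induction i using b.induction_reflect with
    | h₀ i hi =>
      rwa [← affineReflection_zero, ← neg_zero, P.affineReflection_reflectionPerm_self,
        affineReflection_zero]
    | h₁ i hi =>
      exact Subgroup.subset_closure (.inl ⟨i, hi, (P.affineReflection_zero i).symm⟩)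
    | h₂ i j hi hj =>
      have hj' : (P.coreflection j).toAffineEquiv ∈ b.affineWeylGroup :=
        Subgroup.subset_closure (.inl ⟨j, hj, (P.affineReflection_zero j).symm⟩)
      have := P.flip.reflection_reflectionPerm (i := i) (j := j)
      change P.coreflection (P.reflectionPerm j i) =
        P.coreflection j * P.coreflection i * P.coreflection j at this
      rw [this]
      exact mul_mem (mul_mem hj' hi) hj'
  let L : AddSubgroup V' :=
    Subgroup.toAddSubgroup' (b.affineWeylGroup.comap (AffineEquiv.constVAddHom ℝ V'))
  have hL (x : V') : x ∈ L ↔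
    AffineEquiv.constVAddHom ℝ V' (Multiplicative.ofAdd x) ∈ b.affineWeylGroup := Iff.rfl
  have hstab (i : ι) {x : V'} (hx : x ∈ L) : P.coreflection i x ∈ L := by
    rw [hL] at hx ⊢
    convert mul_mem (mul_mem (hrefl i) hx) (hrefl i) using 1
    ext y
    simp
  -- The pairing bound known for `α₀` is invariant under `W`, so `T` is a stable set of roots
  -- containing `α₀`, and it spans by irreducibility.
  let T : Set ι := {j | P.coroot j ∈ L ∧
    ∀ k, k ≠ j → k ≠ P.reflectionPerm j j → P.pairing k j = 0 ∨ P.pairing k j = 1 ∨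
      P.pairing k j = -1}
  have hTstab (i : ι) {j : ι} (hj : j ∈ T) : P.reflectionPerm i j ∈ T := by
    refine ⟨by rw [coroot_reflectionPerm]; exact hstab i hj.1, fun k hk hk' ↦ ?_⟩
    rw [pairing_reflectionPerm]
    refine hj.2 _ (fun h ↦ hk ?_) (fun h ↦ hk' ?_)
    · rw [← h, reflectionPerm_self]
    · refine P.root.injective ?_
      rw [← P.reflectionPerm_self i k, h, root_reflectionPerm, root_reflectionPerm_self,
        root_reflectionPerm_self, root_reflectionPerm, map_neg]
  obtain ⟨i₀, hi₀⟩ := b.exists_isHighestRoot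
  have hi₀T : i₀ ∈ T := by
    constructor
    · rw [hL]
      have h1 : P.affineReflection i₀ 1 ∈ b.affineWeylGroup :=
        Subgroup.subset_closure (.inr ⟨i₀, hi₀, rfl⟩)
      convert mul_mem h1 (hrefl i₀) using 1
      rw [affineReflection_eq_mul, mul_assoc, ← affineReflection_zero, affineReflection_mul_self,
        mul_one, one_smul]
    · intro k hk hk'
      by_cases hpos : b.IsPos k
      · rw [← P.algebraMap_pairingIn ℤ]
        rcases hi₀.pairingIn_eq hpos hk with h | h <;> simp [h]
      · have hneg := (isPos_reflectionPerm_self_iff k).mpr hpos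
        have hne : P.reflectionPerm k k ≠ i₀ := fun h ↦ hk' (by
          rw [← h, reflectionPerm_self_involutive])
        have := hi₀.pairingIn_eq hneg hne
        rw [← neg_neg (P.pairing k i₀), ← pairing_reflectionPerm_self_left,
          ← P.algebraMap_pairingIn ℤ]
        have h2 : P.pairingIn ℤ (P.reflectionPerm k k) i₀ = 0 ∨
          P.pairingIn ℤ (P.reflectionPerm k k) i₀ = 1 := this
        rcases h2 with h | h <;> simp [h]
  have hspan : Submodule.span ℝ (P.root '' T) = ⊤ := by
    refine IsIrreducible.eq_top_of_invtSubmodule_reflection (P := P) _ (fun i ↦ ?_) (fun h ↦ ?_)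
    · refine (Module.End.mem_invtSubmodule _).mpr (Submodule.span_le.mpr ?_)
      rintro _ ⟨j, hj, rfl⟩
      exact Submodule.subset_span ⟨_, hTstab i hj, P.root_reflectionPerm i j⟩
    · have : P.root i₀ ∈ Submodule.span ℝ (P.root '' T) :=
        Submodule.subset_span ⟨i₀, hi₀T, rfl⟩
      exact P.ne_zero i₀ (by simpa [h] using this)
  have hQ : P.corootLattice ≤ L := by
    refine (AddSubgroup.closure_le _).mpr ?_
    rintro _ ⟨i, rfl⟩
    obtain ⟨j, hj, hij⟩ : ∃ j ∈ T, P.pairing i j ≠ 0 := by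
      by_contra! h
      have hle : (⊤ : Submodule ℝ V) ≤ LinearMap.ker (P.coroot' i) := by
        rw [← hspan, Submodule.span_le]
        rintro _ ⟨j, hj, rfl⟩
        simpa using P.pairing_eq_zero_iff.mp (h j hj)
      have := hle (Submodule.mem_top (x := P.root i))
      simp at this
    by_cases h1 : i = j
    · exact h1 ▸ hj.1
    by_cases h2 : i = P.reflectionPerm j j
    · rw [h2, coroot_reflectionPerm]
      exact hstab j hj.1
    -- The difference `α_j^∨ - s_i(α_j^∨)` is `⟨α_i, α_j^∨⟩ α_i^∨`, and the coefficient is 1 or -1.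
    have h3 := sub_mem hj.1 (hstab i hj.1)
    rw [coreflection_apply_coroot, sub_sub_cancel] at h3
    rcases hj.2 i h1 h2 with h | h | h
    · exact absurd h hij
    · simpa [h] using h3
    · simpa [h] using h3
  refine sup_le ?_ ?_
  · rintro _ ⟨l, hl, rfl⟩
    exact hQ hl
  · rintro _ ⟨w, hw, rfl⟩
    induction hw using Subgroup.closure_induction'' with
    | mem v hv => obtain ⟨i, rfl⟩ := hv; exact hrefl i
    | inv_mem v hv => obtain ⟨i, rfl⟩ := hv; exact hrefl i
    | one => exact one_mem _
    | mul v w _ _ hv hw => exact mul_mem hv hw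

end AffineWeylGroup

end RootPairing.Base

namespace RootPairing.Base

/-! ### Intermediate groups are full lattices. -/

section Lattice

variable {ι V V' : Type*} [Finite ι] [AddCommGroup V] [Module ℝ V] [AddCommGroup V'] [Module ℝ V']
  {P : RootPairing ι ℝ V V'} [P.IsRootSystem] (b : P.Base)

include b in
/-- Every group between the coroot lattice and the coweight lattice is a full lattice. -/
lemma isFullLattice_of_corootLattice_le {L : AddSubgroup V'} (hQ : P.corootLattice ≤ L)
    (hP : L ≤ P.coweightLattice) : L.IsFullLattice := by
  have hfloor (j : ι) (x : L) : (⌊P.root' j x⌋ : ℝ) = P.root' j x := by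
    obtain ⟨n, hn⟩ := hP x.2 j
    rw [hn, Int.floor_intCast]
  -- The values on simple roots embed `L` in `ℤ^r`, bounding its rank above; the floor merely reads
  -- off an integer. The coroots in `L` span `V'`, which bounds the rank below.
  let f : AddSubgroup.toIntSubmodule L →ₗ[ℤ] (b.support → ℤ) := AddMonoidHom.toIntLinearMap
    { toFun := fun x j ↦ ⌊P.root' j (x : V')⌋
      map_zero' := by ext; simp
      map_add' := fun x y ↦ by
        ext j
        have h : (⌊P.root' j (x + y : V')⌋ : ℝ) = ⌊P.root' j (x : V')⌋ + ⌊P.root' j (y : V')⌋ := by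
          rw [hfloor j x, hfloor j y, ← map_add]
          exact hfloor j (x + y)
        exact_mod_cast h }
  have hf : Function.Injective f := by
    rw [injective_iff_map_eq_zero]
    intro x hx
    have h0 (j : b.support) : P.root' j (x : V') = 0 := by
      have h : ⌊P.root' j (x : V')⌋ = 0 := congrFun hx j
      rw [← hfloor j x, h, Int.cast_zero]
    have h1 : P.toLinearMap.flip (x : V') = 0 := b.toWeightBasis.ext fun j ↦ by
      rw [toWeightBasis_apply]
      exact h0 j
    have h2 : P.toLinearMap.flip.toPerfPair (x : V') = 0 := h1
    exact Subtype.ext (P.toLinearMap.flip.toPerfPair.map_eq_zero_iff.mp h2)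
  have : Module.Finite ℤ (AddSubgroup.toIntSubmodule L) := Module.Finite.of_injective f hf
  have : Module.Free ℤ (AddSubgroup.toIntSubmodule L) :=
    Module.Free.of_equiv (LinearEquiv.ofInjective f hf).symm
  have hrank : Module.finrank ℝ V' = b.support.card := by
    rw [Module.finrank_eq_card_basis b.toCoweightBasis, Fintype.card_coe]
  have hle : Module.finrank ℤ (AddSubgroup.toIntSubmodule L) ≤ Module.finrank ℝ V' := by
    rw [hrank]
    simpa using LinearMap.finrank_le_finrank_of_injective hf
  let B := Module.finBasis ℤ (AddSubgroup.toIntSubmodule L)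
  let v (i : Fin (Module.finrank ℤ (AddSubgroup.toIntSubmodule L))) : V' := B i
  have hspanZ : Submodule.span ℤ (Set.range v) = AddSubgroup.toIntSubmodule L := by
    have : Set.range v = (AddSubgroup.toIntSubmodule L).subtype '' Set.range B := by
      rw [← Set.range_comp]; rfl
    rw [this, Submodule.span_image, B.span_eq, Submodule.map_top, Submodule.range_subtype]
  have hspan : Submodule.span ℝ (Set.range v) = ⊤ := by
    rw [eq_top_iff, ← IsRootSystem.span_coroot_eq_top (P := P), Submodule.span_le]
    rintro _ ⟨i, rfl⟩
    have h1 : P.coroot i ∈ Submodule.span ℤ (Set.range v) := by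
      rw [hspanZ]
      exact hQ (AddSubgroup.subset_closure (Set.mem_range_self i))
    exact Submodule.span_le_restrictScalars ℤ ℝ _ h1
  have heq : Module.finrank ℤ (AddSubgroup.toIntSubmodule L) = Module.finrank ℝ V' := by
    refine hle.antisymm ?_
    have := finrank_range_le_card (R := ℝ) v
    rwa [Set.finrank, hspan, finrank_top, Fintype.card_fin] at this
  refine ⟨(basisOfTopLeSpanOfCardEqFinrank v hspan.ge (by simpa using heq)).reindex
    (finCongr heq), ?_⟩
  rw [Module.Basis.range_reindex, coe_basisOfTopLeSpanOfCardEqFinrank]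
  have := congrArg Submodule.toAddSubgroup hspanZ
  rw [Submodule.span_int_eq_addSubgroupClosure] at this
  simpa using this.symm

include b in
lemma mem_intermediateLattices_iff {L : AddSubgroup V'} :
    L ∈ P.intermediateLattices ↔ P.corootLattice ≤ L ∧ L ≤ P.coweightLattice :=
  ⟨fun h ↦ h.2, fun h ↦ ⟨⟨b.isFullLattice_of_corootLattice_le h.1 h.2,
    P.apply_mem_of_corootLattice_le h.1 h.2⟩, h⟩⟩

end Lattice

/-! ### The projection onto `Ω` and the lattice correspondence. -/

section Projection

variable {ι V V' : Type*} [Finite ι] [AddCommGroup V] [Module ℝ V] [AddCommGroup V'] [Module ℝ V']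
  {P : RootPairing ι ℝ V V'} [P.IsRootSystem] [P.IsCrystallographic] [P.IsReduced]
  [P.IsIrreducible] (b : P.Base)

/-- Since `p` and `g p` lie in the same alcove, the permutation of roots determines the shifts,
hence `g`; there are finitely many permutations. -/
lemma finite_alcoveStabilizer : Finite b.alcoveStabilizer := by
  obtain ⟨p, hp⟩ := b.openAlcove_nonempty
  choose σ k h using fun g : b.alcoveStabilizer ↦
    P.exists_perm_of_mem_extendedAffineWeylGroup g.2.1
  have hk (g : b.alcoveStabilizer) (i : ι) :
      k g i = ⌊P.root' i p⌋ - ⌊P.root' (σ g i) p⌋ := by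
    have h1 : ⌊P.root' i (g.1 p)⌋ = ⌊P.root' i p⌋ := by
      obtain ⟨n, h1, h2, h3, h4⟩ := exists_floor_of_mem_openAlcove hp i
      obtain ⟨m, h5, h6, h7, h8⟩ :=
        exists_floor_of_mem_openAlcove (apply_mem_openAlcove g.2 hp) i
      have : m = n := by
        by_cases hi : b.IsPos i
        · rw [h3 hi, h7 hi]
        · rw [h4 hi, h8 hi]
      rw [Int.floor_eq_iff.mpr ⟨h1.le, h2⟩, Int.floor_eq_iff.mpr ⟨h5.le, h6⟩, this]
    rw [(h g i).1, Int.floor_add_intCast] at h1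
    lia
  refine Finite.of_injective σ fun g g' hg ↦ Subtype.ext (AffineEquiv.ext fun x ↦ ?_)
  refine P.toLinearMap.flip.toPerfPair.injective (b.toWeightBasis.ext fun j ↦ ?_)
  rw [toWeightBasis_apply]
  change P.root' j (g.1 x) = P.root' j (g'.1 x)
  rw [(h g j).1, (h g' j).1, hk, hk, hg]

/-- A conjugate of a wall reflection is the reflection in another affine root hyperplane, which lies
in `t(Q^∨) ⋊ W = W_a`. -/
lemma conj_mem_affineWeylGroup {g : V' ≃ᵃ[ℝ] V'} (hg : g ∈ P.extendedAffineWeylGroup)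
    {n : V' ≃ᵃ[ℝ] V'} (hn : n ∈ b.affineWeylGroup) : g * n * g⁻¹ ∈ b.affineWeylGroup := by
  obtain ⟨σ, k, h⟩ := P.exists_perm_of_mem_extendedAffineWeylGroup hg
  rw [affineWeylGroup_eq_closure] at hn
  induction hn using Subgroup.closure_induction with
  | mem x hx =>
    obtain ⟨⟨⟨j, m⟩, hq⟩, rfl⟩ := hx
    obtain ⟨i, rfl⟩ := σ.surjective j
    have := P.affineReflection_mul_eq (h i).1 (h i).2 m
    change g * P.affineReflection (σ i) m * g⁻¹ ∈ _
    rw [← this, mul_inv_cancel_right, affineWeylGroup_eq]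
    exact P.affineReflection_mem_intermediate _ _
  | one => simp
  | mul x y _ _ hx hy =>
    have := mul_mem hx hy
    rwa [show g * x * g⁻¹ * (g * y * g⁻¹) = g * (x * y) * g⁻¹ by group] at this
  | inv x _ hx =>
    have := inv_mem hx
    rwa [show (g * x * g⁻¹)⁻¹ = g * x⁻¹ * g⁻¹ by group] at this

lemma affineWeylGroup_inf_alcoveStabilizer : b.affineWeylGroup ⊓ b.alcoveStabilizer = ⊥ := by
  obtain ⟨p, hp⟩ := b.openAlcove_nonempty
  rw [eq_bot_iff]
  rintro g ⟨hg, hg'⟩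
  exact eq_one_of_apply_mem_openAlcove hp hg (apply_mem_openAlcove hg' hp)

/-- The extended affine Weyl group is the internal semidirect product of the affine Weyl group and
the stabilizer of the fundamental alcove. -/
lemma isInternalSemidirect_extendedAffineWeylGroup :
    P.extendedAffineWeylGroup.IsInternalSemidirect b.affineWeylGroup b.alcoveStabilizer :=
  .of_disjoint b.affineWeylGroup_le_extended (fun _ h ↦ h.1)
    (fun _ hg _ hn ↦ b.conj_mem_affineWeylGroup hg hn) b.affineWeylGroup_inf_alcoveStabilizer
    (fun _ hg ↦ b.exists_eq_mul_of_mem_extendedAffineWeylGroup hg)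

lemma existsUnique_isNaturalProjection :
    ∃! π : P.extendedAffineWeylGroup →* b.alcoveStabilizer, b.IsNaturalProjection π := by
  obtain ⟨π, hπ⟩ := b.isInternalSemidirect_extendedAffineWeylGroup.exists_projection
  refine ⟨π, hπ, fun π' hπ' ↦ MonoidHom.ext fun g ↦ ?_⟩
  obtain ⟨w, hw, ω, hω, h⟩ := b.exists_eq_mul_of_mem_extendedAffineWeylGroup g.2
  rw [hπ g w hw ⟨ω, hω⟩ h, hπ' g w hw ⟨ω, hω⟩ h]

omit [Finite ι] [P.IsRootSystem] [P.IsCrystallographic] [P.IsReduced] [P.IsIrreducible] in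
variable (P) in
lemma constVAddHom_mem_extendedAffineWeylGroup (l : Multiplicative P.coweightLattice) :
    ((AffineEquiv.constVAddHom ℝ V').comp
      (AddMonoidHom.toMultiplicative P.coweightLattice.subtype)) l ∈ P.extendedAffineWeylGroup :=
  Subgroup.mem_sup_left ⟨Multiplicative.ofAdd l.toAdd.1, l.toAdd.2, rfl⟩

variable {b} (π : P.extendedAffineWeylGroup →* b.alcoveStabilizer)

/-- The homomorphism `λ ↦ π(t_λ)` from the coweight lattice to the stabilizer of the alcove. -/
noncomputable def coweightHom : Multiplicative P.coweightLattice →* b.alcoveStabilizer :=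
  π.comp (((AffineEquiv.constVAddHom ℝ V').comp
    (AddMonoidHom.toMultiplicative P.coweightLattice.subtype)).codRestrict _
      (constVAddHom_mem_extendedAffineWeylGroup P))

/-- A subgroup of `V'`, intersected with the coweight lattice and written multiplicatively. -/
def restrictToCoweightLattice (P : RootPairing ι ℝ V V') (L : AddSubgroup V') :
    Subgroup (Multiplicative P.coweightLattice) :=
  AddSubgroup.toSubgroup (L.addSubgroupOf P.coweightLattice)

variable {π}

lemma IsNaturalProjection.eq_one_iff (hπ : b.IsNaturalProjection π)
    (g : P.extendedAffineWeylGroup) : π g = 1 ↔ (g : V' ≃ᵃ[ℝ] V') ∈ b.affineWeylGroup := by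
  constructor
  · intro h
    obtain ⟨w, hw, ω, hω, hg⟩ := b.exists_eq_mul_of_mem_extendedAffineWeylGroup g.2
    have h1 := (hπ g w hw ⟨ω, hω⟩ hg).symm.trans h
    rw [hg, show ω = 1 from congrArg Subtype.val h1, mul_one]
    exact hw
  · exact fun h ↦ hπ g g h 1 (by simp)

omit [Finite ι] [P.IsRootSystem] [P.IsCrystallographic] [P.IsReduced] [P.IsIrreducible] in
lemma IsNaturalProjection.apply_alcoveStabilizer (hπ : b.IsNaturalProjection π)
    (ω : b.alcoveStabilizer) : π ⟨ω, ω.2.1⟩ = ω :=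
  hπ _ 1 (one_mem _) _ (by simp)

lemma IsNaturalProjection.ker_coweightHom (hπ : b.IsNaturalProjection π) :
    (coweightHom π).ker = restrictToCoweightLattice P P.corootLattice := by
  ext l
  rw [MonoidHom.mem_ker]
  refine (hπ.eq_one_iff _).trans ?_
  rw [affineWeylGroup_eq, P.mem_intermediateAffineWeylGroup_iff
    (P.apply_mem_of_corootLattice_le le_rfl P.corootLattice_le_coweightLattice)]
  change _ ↔ (l.toAdd : V') ∈ P.corootLattice
  constructor
  · rintro ⟨m, hm, w, -, h⟩
    have := h 0
    change (l.toAdd : V') + 0 = w 0 + m at this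
    rw [map_zero, zero_add, add_zero] at this
    rwa [this]
  · exact fun h ↦ ⟨_, h, 1, one_mem _, fun x ↦ add_comm _ _⟩

/-- An element of `W_L` is `t_l w`, and `π` kills `w` because `W` lies in `W_a`; so only
translations contribute. -/
lemma IsNaturalProjection.omegaOfLattice_eq (hπ : b.IsNaturalProjection π) {L : AddSubgroup V'}
    (hQ : P.corootLattice ≤ L) (hP : L ≤ P.coweightLattice) :
    omegaOfLattice π L = (restrictToCoweightLattice P L).map (coweightHom π) := by
  ext ω
  constructor
  · rintro ⟨g, hg, rfl⟩
    obtain ⟨l, hl, w, hw, h⟩ := (P.mem_intermediateAffineWeylGroup_iff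
      (P.apply_mem_of_corootLattice_le hQ hP)).mp hg
    refine ⟨Multiplicative.ofAdd ⟨l, hP hl⟩, hl, ?_⟩
    have hw' : w.toAffineEquiv ∈ b.affineWeylGroup := by
      rw [affineWeylGroup_eq]
      exact Subgroup.mem_sup_right ⟨w, hw, rfl⟩
    have hg' : g = ⟨_, constVAddHom_mem_extendedAffineWeylGroup P
        (Multiplicative.ofAdd ⟨l, hP hl⟩)⟩ * ⟨_, b.affineWeylGroup_le_extended hw'⟩ := by
      refine Subtype.ext (AffineEquiv.ext fun x ↦ ?_)
      exact (h x).trans (add_comm _ _)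
    rw [hg', map_mul, (hπ.eq_one_iff ⟨_, b.affineWeylGroup_le_extended hw'⟩).mpr hw', mul_one]
    rfl
  · rintro ⟨l, hl, rfl⟩
    exact ⟨_, Subgroup.mem_sup_left ⟨Multiplicative.ofAdd l.toAdd.1, hl, rfl⟩, rfl⟩

lemma IsNaturalProjection.coweightHom_surjective (hπ : b.IsNaturalProjection π) :
    Function.Surjective (coweightHom π) := by
  intro ω
  have h : ω ∈ omegaOfLattice π P.coweightLattice :=
    ⟨⟨ω, ω.2.1⟩, ω.2.1, hπ.apply_alcoveStabilizer ω⟩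
  rw [hπ.omegaOfLattice_eq P.corootLattice_le_coweightLattice le_rfl] at h
  obtain ⟨l, -, hl⟩ := h
  exact ⟨l, hl⟩

omit [Finite ι] [P.IsRootSystem] [P.IsCrystallographic] [P.IsReduced] [P.IsIrreducible] in
lemma mem_latticeOfSubgroup_iff {H : Subgroup b.alcoveStabilizer} {x : V'} :
    x ∈ latticeOfSubgroup π H ↔
      ∃ h : x ∈ P.coweightLattice, coweightHom π (Multiplicative.ofAdd ⟨x, h⟩) ∈ H := by
  constructor
  · rintro ⟨⟨g, hg, hgx⟩, hx⟩
    have h : g = ⟨_, constVAddHom_mem_extendedAffineWeylGroup P (Multiplicative.ofAdd ⟨x, hx⟩)⟩ :=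
      Subtype.ext hgx
    rw [h] at hg
    exact ⟨hx, hg⟩
  · rintro ⟨hx, h⟩
    exact ⟨⟨_, h, rfl⟩, hx⟩

omit [Finite ι] [P.IsRootSystem] [P.IsCrystallographic] [P.IsReduced] [P.IsIrreducible] in
lemma restrictToCoweightLattice_latticeOfSubgroup (H : Subgroup b.alcoveStabilizer) :
    restrictToCoweightLattice P (latticeOfSubgroup π H) = H.comap (coweightHom π) := by
  ext l
  refine (mem_latticeOfSubgroup_iff (x := (l.toAdd : V'))).trans ⟨fun h ↦ h.2, fun h ↦ ⟨_, h⟩⟩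

omit [Finite ι] [P.IsRootSystem] [P.IsCrystallographic] [P.IsReduced] [P.IsIrreducible] in
lemma restrictToCoweightLattice_mono {L M : AddSubgroup V'} (h : L ≤ M) :
    restrictToCoweightLattice P L ≤ restrictToCoweightLattice P M :=
  fun _ hx ↦ h hx

lemma IsNaturalProjection.latticeOfSubgroup_mem (hπ : b.IsNaturalProjection π)
    (H : Subgroup b.alcoveStabilizer) : latticeOfSubgroup π H ∈ P.intermediateLattices := by
  refine (mem_intermediateLattices_iff b).mpr ⟨fun x hx ↦ ?_, fun x hx ↦ hx.2⟩
  refine mem_latticeOfSubgroup_iff.mpr ⟨P.corootLattice_le_coweightLattice hx, ?_⟩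
  have : Multiplicative.ofAdd (⟨x, P.corootLattice_le_coweightLattice hx⟩ : P.coweightLattice) ∈
      (coweightHom π).ker := by
    rw [hπ.ker_coweightHom]
    exact hx
  rw [MonoidHom.mem_ker.mp this]
  exact one_mem H

/-- Correspondence theorem for `coweightHom π`, which is surjective with kernel `Q^∨`. -/
lemma IsNaturalProjection.invOn (hπ : b.IsNaturalProjection π) :
    Set.InvOn (latticeOfSubgroup π) (omegaOfLattice π) P.intermediateLattices Set.univ := by
  constructor
  · intro L hL
    have hker : (coweightHom π).ker ≤ restrictToCoweightLattice P L :=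
      hπ.ker_coweightHom ▸ restrictToCoweightLattice_mono hL.2.1
    ext x
    rw [mem_latticeOfSubgroup_iff, hπ.omegaOfLattice_eq hL.2.1 hL.2.2]
    simp_rw [← Subgroup.mem_comap, Subgroup.comap_map_eq, sup_eq_left.mpr hker]
    exact ⟨fun ⟨_, h⟩ ↦ h, fun h ↦ ⟨hL.2.2 h, h⟩⟩
  · intro H _
    have hL := hπ.latticeOfSubgroup_mem H
    rw [hπ.omegaOfLattice_eq hL.2.1 hL.2.2, restrictToCoweightLattice_latticeOfSubgroup,
      Subgroup.map_comap_eq_self_of_surjective hπ.coweightHom_surjective]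

lemma IsNaturalProjection.index_omegaOfLattice (hπ : b.IsNaturalProjection π) {L : AddSubgroup V'}
    (hQ : P.corootLattice ≤ L) (hP : L ≤ P.coweightLattice) :
    (omegaOfLattice π L).index = L.relIndex P.coweightLattice := by
  rw [hπ.omegaOfLattice_eq hQ hP, Subgroup.index_map_eq _ hπ.coweightHom_surjective
    (hπ.ker_coweightHom ▸ restrictToCoweightLattice_mono hQ), restrictToCoweightLattice,
    AddSubgroup.index_toSubgroup]
  rfl

lemma IsNaturalProjection.card_omegaOfLattice (hπ : b.IsNaturalProjection π) {L : AddSubgroup V'}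
    (hQ : P.corootLattice ≤ L) (hP : L ≤ P.coweightLattice) :
    Nat.card (omegaOfLattice π L) = P.corootLattice.relIndex L := by
  rw [hπ.omegaOfLattice_eq hQ hP, ← Subgroup.relIndex_ker, hπ.ker_coweightHom,
    restrictToCoweightLattice, restrictToCoweightLattice, AddSubgroup.relIndex_toSubgroup,
    AddSubgroup.relIndex_addSubgroupOf hP]

lemma IsNaturalProjection.isInternalSemidirect_intermediate (hπ : b.IsNaturalProjection π)
    {L : AddSubgroup V'} (hQ : P.corootLattice ≤ L) (hP : L ≤ P.coweightLattice) :
    (P.intermediateAffineWeylGroup L).IsInternalSemidirect b.affineWeylGroup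
      ((omegaOfLattice π L).map b.alcoveStabilizer.subtype) := by
  have hN : b.affineWeylGroup ≤ P.intermediateAffineWeylGroup L := by
    rw [affineWeylGroup_eq]
    exact sup_le_sup_right (Subgroup.map_mono fun _ hx ↦ hQ hx) _
  have hext : P.intermediateAffineWeylGroup L ≤ P.extendedAffineWeylGroup :=
    sup_le_sup_right (Subgroup.map_mono fun _ hx ↦ hP hx) _
  refine .of_disjoint hN ?_ (fun g hg n hn ↦ b.conj_mem_affineWeylGroup (hext hg) hn) ?_ ?_
  · rintro _ ⟨_, ⟨g, hg, rfl⟩, rfl⟩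
    obtain ⟨w, hw, ω, hω, h⟩ := b.exists_eq_mul_of_mem_extendedAffineWeylGroup g.2
    rw [hπ g w hw ⟨ω, hω⟩ h]
    change ω ∈ _
    -- The component `ω = w⁻¹ g` stays in `W_L` because `W_a ≤ W_L`.
    rw [← inv_mul_eq_of_eq_mul h]
    exact mul_mem (inv_mem (hN hw)) hg
  · rw [eq_bot_iff, ← b.affineWeylGroup_inf_alcoveStabilizer]
    refine inf_le_inf_left _ ?_
    rintro _ ⟨ω, -, rfl⟩
    exact ω.2
  · intro g hg
    obtain ⟨w, hw, ω, hω, h⟩ := b.exists_eq_mul_of_mem_extendedAffineWeylGroup (hext hg)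
    exact ⟨w, hw, ω, ⟨⟨ω, hω⟩, ⟨⟨g, hext hg⟩, hg, hπ _ w hw ⟨ω, hω⟩ h⟩, rfl⟩, h⟩

end Projection

end RootPairing.Base

theorem mainTheorem9 {ι V V' : Type*} [Finite ι]
    [AddCommGroup V] [Module ℝ V] [AddCommGroup V'] [Module ℝ V']
    (P : RootPairing ι ℝ V V')
    [P.IsRootSystem] [P.IsCrystallographic] [P.IsReduced] [P.IsIrreducible] (b : P.Base) :
    -- the decomposition of the extended affine Weyl group, and the projection `π` it defines
    P.extendedAffineWeylGroup.IsInternalSemidirect b.affineWeylGroup b.alcoveStabilizer ∧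
    Finite b.alcoveStabilizer ∧
    (∃! π : P.extendedAffineWeylGroup →* b.alcoveStabilizer, b.IsNaturalProjection π) ∧
    ∀ π : P.extendedAffineWeylGroup →* b.alcoveStabilizer, b.IsNaturalProjection π →
      -- the two maps are mutually inverse bijections
      Set.BijOn (RootPairing.Base.omegaOfLattice π) P.intermediateLattices Set.univ ∧
      Set.BijOn (RootPairing.Base.latticeOfSubgroup π) Set.univ P.intermediateLattices ∧
      Set.InvOn (RootPairing.Base.latticeOfSubgroup π) (RootPairing.Base.omegaOfLattice π)
        P.intermediateLattices Set.univ ∧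
      ∀ L ∈ P.intermediateLattices,
        -- `[Ω : Ω_L] = [P^∨ : L]` and `|Ω_L| = [L : Q^∨]`
        (RootPairing.Base.omegaOfLattice π L).index = L.relIndex P.coweightLattice ∧
        Nat.card (RootPairing.Base.omegaOfLattice π L) = P.corootLattice.relIndex L ∧
        -- `W_L = W_a ⋊ Ω_L`
        (P.intermediateAffineWeylGroup L).IsInternalSemidirect b.affineWeylGroup
          ((RootPairing.Base.omegaOfLattice π L).map b.alcoveStabilizer.subtype) := by
  refine ⟨b.isInternalSemidirect_extendedAffineWeylGroup, b.finite_alcoveStabilizer,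
    b.existsUnique_isNaturalProjection, fun π hπ ↦ ⟨?_, ?_, hπ.invOn, fun L hL ↦
      ⟨hπ.index_omegaOfLattice hL.2.1 hL.2.2, hπ.card_omegaOfLattice hL.2.1 hL.2.2,
        hπ.isInternalSemidirect_intermediate hL.2.1 hL.2.2⟩⟩⟩
  · exact hπ.invOn.bijOn (Set.mapsTo_univ _ _) fun H _ ↦ hπ.latticeOfSubgroup_mem H
  · exact hπ.invOn.symm.bijOn (fun H _ ↦ hπ.latticeOfSubgroup_mem H) (Set.mapsTo_univ _ _)
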